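/- Let $\kappa$ be a regular uncountable cardinal and let $\lambda$ be a singular cardinal with $\mathrm{cf}(\lambda)\ge\kappa$. For cardinals $\rho$ and sets $S$ put $P_\rho(S)=\{a\subseteq S:|a|<\rho\}$. For a cardinal $\tau\ge\kappa$, an ideal on $P_\kappa(\tau)$ is a proper family $J$ of subsets of $P_\kappa(\tau)$, closed under subsets and under unions of fewer than $\kappa$ members, that contains every $A\subseteq P_\kappa(\tau)$ which is not $\subseteq$-cofinal in $P_\kappa(\tau)$; $J^+$ is the family of subsets of $P_\kappa(\tau)$ not in $J$, and for $A\in J^+$, $J|A=\{B\subseteq P_\kappa(\tau):B\cap A\in J\}$. For a cardinal $2\le\theta\le\kappa$, $J$ is $[\tau]^{<\theta}$-normal if for every $A\in J^+$ and every function $f$ on $A$ with $f(a)\in P_{|a\cap\theta|}(a)$ for all $a\in A$, $f$ is constant on some $B\in J^+$ with $B\subseteq A$. If such ideals exist, $NS_{\kappa,\tau}^{[\tau]^{<\theta}}$ denotes the smallest one. $NS_{\kappa,\tau}$ is the ideal of nonstationary subsets of $P_\kappa(\tau)$ (those disjoint from some closed unbounded set). $\overline{\mathrm{cof}}(J)$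 is the least size of a $Y\subseteq J$ such that every member of $J$ is covered by the union of fewer than $\kappa$ members of $Y$. Put $\overline\theta=\nu$ if $\theta=\kappa=\nu^+$, and $\overline\theta=\theta$ otherwise. Let $M_J$ be the collection of all $Q\subseteq J^+$ such that $A\cap B\in J$ for distinct $A,B\in Q$ and every $C\in J^+$ has $A\cap C\in J^+$ for some $A\in Q$. $J$ is precipitous if for every $A\in J^+$ and all $Q_n\in M_{J|A}$ $(n<\omega)$ such that each member of $Q_{n+1}$ is included in a member of $Q_n$, there are $f(n)\in Q_n$ with $f(0)\supseteq f(1)\supseteq\cdots$ and $\bigcap_{n<\omega}f(n)\ne\emptyset$. $J$ is nowhere precipitous if $J|A$ is not precipitous for any $A\in J^+$. (1) Let $\theta$ be a cardinal with $2\le\theta\le\kappa$ such that there is a $[\lambda]^{<\theta}$-normal ideal on $P_\kappa(\lambda)$ (it then follows that there is a $[\tau]^{<\theta}$-normal ideal on $P_\kappa(\tau)$ for every cardinal $\tau$ with $\kappa\le\tau<\lambda$). Suppose that for every cardinal $\tau$ with $\kappa\le\tau<\lambda$ we have $\tau^{\mathrm{cf}(\lambda)}<\lambda$ and $\overline{\mathrm{cof}}(NS_{\kappa,\tau}^{[\tau]^{<\theta}})\le\lambda^{<\overline\theta}$.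 Then $NS_{\kappa,\lambda}^{[\lambda]^{<\theta}}$ is nowhere precipitous. (2) In particular, if $\lambda$ is a strong limit cardinal, then $NS_{\kappa,\lambda}$ is nowhere precipitous. -/

import Mathlib

open Cardinal Ordinal Set

universe u

namespace PKappaLambda

/-- `P_ρ(S)`: the subsets of `S` of cardinality `< ρ`.  Cardinals are identified with initial
ordinals, and an ordinal with the set of smaller ordinals; sets of ordinals of universe `u` live
one universe higher, whence the lifts below. -/
def smallSubsets (ρ : Cardinal.{u + 1}) (S : Set Ordinal.{u}) : Set (Set Ordinal.{u}) :=
  {a | a ⊆ S ∧ #a < ρ}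

/-- `P_κ(λ)`. -/
def PK (κ lam : Cardinal.{u}) : Set (Set Ordinal.{u}) :=
  smallSubsets (Cardinal.lift.{u + 1} κ) (Iio lam.ord)

/-- `I_{κ,λ}`: the noncofinal subsets of `P_κ(λ)`. -/
def noncofinal (κ lam : Cardinal.{u}) : Set (Set (Set Ordinal.{u})) :=
  {A | A ⊆ PK κ lam ∧ ∃ b ∈ PK κ lam, {a ∈ A | b ⊆ a} = ∅}

/-- `J` is a (proper, `κ`-complete, fine) ideal on `P_κ(λ)`. -/
structure IsIdealOn (κ lam : Cardinal.{u}) (J : Set (Set (Set Ordinal.{u}))) : Prop where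
  subset_PK : ∀ A ∈ J, A ⊆ PK κ lam
  noncofinal_subset : noncofinal κ lam ⊆ J
  PK_notMem : PK κ lam ∉ J
  downward : ∀ A ∈ J, ∀ B, B ⊆ A → B ∈ J
  sUnion_mem : ∀ X, X ⊆ J → #X < Cardinal.lift.{u + 1} κ → ⋃₀ X ∈ J

/-- `J⁺`, the `J`-positive subsets of `P_κ(λ)`. -/
def positive (κ lam : Cardinal.{u}) (J : Set (Set (Set Ordinal.{u}))) :
    Set (Set (Set Ordinal.{u})) :=
  {A | A ⊆ PK κ lam ∧ A ∉ J}

/-- `J ∣ A`. -/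
def restrict (κ lam : Cardinal.{u}) (J : Set (Set (Set Ordinal.{u})))
    (A : Set (Set Ordinal.{u})) : Set (Set (Set Ordinal.{u})) :=
  {B | B ⊆ PK κ lam ∧ B ∩ A ∈ J}

/-- `Q ∈ M_J`: `Q` is a maximal family of pairwise `J`-almost disjoint `J`-positive sets. -/
structure IsMaxAlmostDisjoint (κ lam : Cardinal.{u}) (J : Set (Set (Set Ordinal.{u})))
    (Q : Set (Set (Set Ordinal.{u}))) : Prop where
  subset_positive : Q ⊆ positive κ lam J
  inter_mem : ∀ A ∈ Q, ∀ B ∈ Q, A ≠ B → A ∩ B ∈ J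
  maximal : ∀ C ∈ positive κ lam J, ∃ A ∈ Q, A ∩ C ∈ positive κ lam J

def IsPrecipitous (κ lam : Cardinal.{u}) (J : Set (Set (Set Ordinal.{u}))) : Prop :=
  ∀ A ∈ positive κ lam J, ∀ Q : ℕ → Set (Set (Set Ordinal.{u})),
    (∀ n, IsMaxAlmostDisjoint κ lam (restrict κ lam J A) (Q n)) →
    (∀ n, ∀ C ∈ Q (n + 1), ∃ B ∈ Q n, C ⊆ B) →
    ∃ f : ℕ → Set (Set Ordinal.{u}),
      (∀ n, f n ∈ Q n) ∧ (∀ n, f (n + 1) ⊆ f n) ∧ (⋂ n, f n).Nonempty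

def IsNowherePrecipitous (κ lam : Cardinal.{u}) (J : Set (Set (Set Ordinal.{u}))) : Prop :=
  ∀ A ∈ positive κ lam J, ¬ IsPrecipitous κ lam (restrict κ lam J A)

/-- The reduced cofinality of `J`: the least size of a `Y ⊆ J` such that every member of `J` is
covered by the union of fewer than `κ` members of `Y`. -/
noncomputable def cofBar (κ : Cardinal.{u}) (J : Set (Set (Set Ordinal.{u}))) :
    Cardinal.{u + 1} :=
  sInf {c | ∃ Y : Set (Set (Set Ordinal.{u})), Y ⊆ J ∧
    (∀ A ∈ J, ∃ y, y ⊆ Y ∧ #y < Cardinal.lift.{u + 1} κ ∧ A ⊆ ⋃₀ y) ∧ #Y = c}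

/-- `J` is a `[μ]^{<θ}`-normal ideal on `P_κ(λ)`: every `f` on a positive set `A` with
`f(a) ∈ P_{|a ∩ θ|}(a ∩ μ)` for all `a ∈ A` (hence with values in `P_θ(μ)`) is constant on a
positive subset of `A`. -/
structure IsNormalIdeal (κ lam μ θ : Cardinal.{u}) (J : Set (Set (Set Ordinal.{u}))) : Prop
    extends IsIdealOn κ lam J where
  exists_const : ∀ A ∈ positive κ lam J, ∀ f : Set Ordinal.{u} → Set Ordinal.{u},
    (∀ a ∈ A, f a ∈ smallSubsets #(a ∩ Iio θ.ord : Set Ordinal.{u}) (a ∩ Iio μ.ord)) →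
    ∃ B ∈ positive κ lam J, B ⊆ A ∧ ∃ e, ∀ a ∈ B, f a = e

/-- `NS_{κ,λ}^{[μ]^{<θ}}`, the smallest `[μ]^{<θ}`-normal ideal on `P_κ(λ)`, as the intersection
of all of them (see `isLeast_NSnormal`). -/
def NSnormal (κ lam μ θ : Cardinal.{u}) : Set (Set (Set Ordinal.{u})) :=
  ⋂₀ {J | IsNormalIdeal κ lam μ θ J}

theorem isLeast_NSnormal {κ lam μ θ : Cardinal.{u}} (h : ∃ J, IsNormalIdeal κ lam μ θ J) :
    IsLeast {J | IsNormalIdeal κ lam μ θ J} (NSnormal κ lam μ θ) := by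
  refine ⟨?_, fun J hJ => sInter_subset_of_mem hJ⟩
  obtain ⟨J₀, h₀⟩ := h
  refine ⟨⟨fun A hA => h₀.subset_PK A (hA J₀ h₀), ?_, fun hP => h₀.PK_notMem (hP J₀ h₀), ?_, ?_⟩,
    ?_⟩
  · exact fun A hA J hJ => hJ.noncofinal_subset hA
  · exact fun A hA B hB J hJ => hJ.downward A (hA J hJ) B hB
  · exact fun X hX hc J hJ => hJ.sUnion_mem X (fun A hA => hX hA J hJ) hc
  · rintro A ⟨hA, hAn⟩ f hf
    obtain ⟨J, hJ, hAJ⟩ : ∃ J, IsNormalIdeal κ lam μ θ J ∧ A ∉ J := by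
      by_contra! hc
      exact hAn fun J hJ => hc J hJ
    obtain ⟨B, ⟨hB, hBJ⟩, hBA, hconst⟩ := hJ.exists_const A ⟨hA, hAJ⟩ f hf
    exact ⟨B, ⟨hB, fun hBn => hBJ (hBn J hJ)⟩, hBA, hconst⟩

open Classical in
/-- `θ̄`: equal to `ν` if `θ = κ = ν⁺`, and to `θ` otherwise. -/
noncomputable def thetaBar (κ θ : Cardinal.{u}) : Cardinal.{u} :=
  if h : θ = κ ∧ ∃ ν : Cardinal.{u}, κ = Order.succ ν then h.2.choose else θ

/-- Closed unbounded subsets of `P_κ(λ)`. -/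
structure IsClubIn (κ lam : Cardinal.{u}) (C : Set (Set Ordinal.{u})) : Prop where
  subset_PK : C ⊆ PK κ lam
  unbounded : ∀ b ∈ PK κ lam, ∃ a ∈ C, b ⊆ a
  closed : ∀ X, X ⊆ C → X.Nonempty → IsChain (· ⊆ ·) X → #X < Cardinal.lift.{u + 1} κ →
    ⋃₀ X ∈ C

/-- `NS_{κ,λ}`, the ideal of nonstationary subsets of `P_κ(λ)`. -/
def nonstationary (κ lam : Cardinal.{u}) : Set (Set (Set Ordinal.{u})) :=
  {A | A ⊆ PK κ lam ∧ ∃ C, IsClubIn κ lam C ∧ A ∩ C = ∅}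

end PKappaLambda

-- Put `μ = cf λ`, so `κ ≤ μ` and `2 ^ μ ≤ κ ^ μ < λ`. The heart of the proof is that the minimal
-- normal ideal is generated in a very economical way: there is a set `D` such that `Z` is in the
-- ideal iff, for some `g : μ → P_κ(λ)`, no `a ∈ Z ∩ D` is closed under `g` on `a ∩ μ`. Only `μ`
-- many values of `g` are involved, whereas the usual description of such ideals uses functions
-- defined on `λ` or on its small subsets.
--
-- This is `NSnormal_eq_ladderIdeal`. Fix cardinals `Λ j < λ`, `j < μ`, bounding the members of
-- `P_κ(λ)`. Since `λ ^ c ≤ λ` for `c < cf λ`, the hypothesis on reduced cofinality gives each ideal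
-- on `P_κ(Λ j)` generators `y j ξ` coded by ordinals `ξ < λ`. A member of that ideal is then
-- captured by a single element of `P_κ(λ)`, namely the set of codes of the generators covering it.
-- Letting `g j` be this element, closure of `a` under `g` forces the trace of `a` on `Λ j` out of
-- the given small set, for every `j ∈ a ∩ μ`.
--
-- Nowhere precipitousness then follows from a counting argument (`IsSliceRank.exists_lt`). Slice
-- `P_κ(λ)` along `a ↦ a ∩ μ`. On one slice, the test posed by `g` depends only on the graph of `g`
-- over `a ∩ μ`, and `a` passes it iff this graph is a subset of `a ×ˢ a`; so `a` passes at most `2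
-- ^ μ` tests. Hence a slice of size at least `2 ^ μ` carries no more tests than elements, while
-- smaller slices are negligible because `2 ^ μ < λ`. Enumerating the tests of a slice and giving
-- each one a passing element of larger rank produces a positive subset whose members are
-- injectively ranked by strictly smaller ordinals. Iterating along maximal almost disjoint
-- families, a common point of a decreasing branch would carry an infinite descent of ranks.
--
-- For strong limit `λ`, take `θ = 2`: the nonstationary ideal is then the smallest normal ideal,
-- and the cardinal hypotheses hold by crude estimates.

universe v

namespace PKappaLambda

/-! ### Slice ranks and the combinatorial step that lowers them. -/

section Descent

/-- A set of cardinality at most `c` can be enumerated injectively by ordinals below `c.ord`. -/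
theorem exists_injOn_lt_ord {α : Type v} (S : Set α) {c : Cardinal.{v}} (h : #S ≤ c) :
    ∃ f : α → Ordinal.{v}, InjOn f S ∧ ∀ a ∈ S, f a < c.ord := by
  classical
  have h' : Cardinal.lift.{v + 1} #S ≤ Cardinal.lift.{v} #(Iio c.ord) := by
    rw [Cardinal.mk_Iio_ordinal, card_ord, Cardinal.lift_id'.{v, v + 1}]
    exact Cardinal.lift_le.2 h
  obtain ⟨e⟩ := Cardinal.lift_mk_le'.1 h'
  refine ⟨fun a => if ha : a ∈ S then e ⟨a, ha⟩ else 0, ?_, ?_⟩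
  · intro a ha b hb hab
    simp only [ha, hb, dite_true] at hab
    simpa using e.injective (Subtype.ext hab)
  · intro a ha
    simp only [ha, dite_true]
    exact (e ⟨a, ha⟩).2

/-- A rank into `Cardinal × Ordinal` that enumerates every slice of `T` along `π`: its first
component is constant on slices and bounds the second one, which is injective on slices. -/
structure IsSliceRank {α β : Type v} (π : α → β) (T : Set α)
    (r : α → Cardinal.{v} × Ordinal.{v}) : Prop where
  fst_eq : ∀ a ∈ T, ∀ b ∈ T, π a = π b → (r a).1 = (r b).1
  inj : ∀ a ∈ T, ∀ b ∈ T, π a = π b → (r a).2 = (r b).2 → a = b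
  lt_ord : ∀ a ∈ T, (r a).2 < (r a).1.ord

variable {α β γ δ : Type v} {π : α → β}

theorem IsSliceRank.mono {T T' : Set α} {r : α → Cardinal.{v} × Ordinal.{v}}
    (h : IsSliceRank π T r) (hT : T' ⊆ T) : IsSliceRank π T' r :=
  ⟨fun a ha b hb => h.fst_eq a (hT ha) b (hT hb), fun a ha b hb => h.inj a (hT ha) b (hT hb),
    fun a ha => h.lt_ord a (hT ha)⟩

theorem exists_isSliceRank (π : α → β) (T : Set α) :
    ∃ r, IsSliceRank π T r ∧ ∀ a, (r a).1 = #{b ∈ T | π b = π a} := by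
  choose f hf hf' using fun x => exists_injOn_lt_ord {b ∈ T | π b = x} le_rfl
  refine ⟨fun a => (#{b ∈ T | π b = π a}, f (π a) a), ⟨?_, ?_, ?_⟩, fun a => rfl⟩
  · intro a _ b _ hab
    simp only [hab]
  · intro a ha b hb hab h
    simp only [hab] at h
    exact hf (π b) ⟨ha, hab⟩ ⟨hb, rfl⟩ h
  · exact fun a ha => hf' _ _ ⟨ha, rfl⟩

theorem mk_le_of_lt_ord {S : Set α} {f : α → Ordinal.{v}} {o : Ordinal.{v}} (hf : InjOn f S)
    (h : ∀ a ∈ S, f a < o) : #S ≤ o.card := by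
  have h1 := Cardinal.mk_image_eq_of_injOn_lift f S hf
  have h2 : #(f '' S) ≤ #(Iio o) := by
    apply Cardinal.mk_le_mk_of_subset
    rintro _ ⟨a, ha, rfl⟩
    exact h a ha
  rw [Cardinal.mk_Iio_ordinal] at h2
  rw [Cardinal.lift_id'.{v, v + 1}] at h1
  rw [h1] at h2
  exact Cardinal.lift_le.1 h2

theorem IsSliceRank.mk_slice_le {T : Set α} {r : α → Cardinal.{v} × Ordinal.{v}}
    (h : IsSliceRank π T r) {a : α} (ha : a ∈ T) : #{b ∈ T | π b = π a} ≤ (r a).1 := by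
  have := mk_le_of_lt_ord (S := {b ∈ T | π b = π a}) (f := fun b => (r b).2) (o := (r a).1.ord)
    (fun b hb c hc hbc => h.inj b hb.1 c hc.1 (hb.2.trans hc.2.symm) hbc) (fun b hb => by
      rw [h.fst_eq a ha b hb.1 hb.2.symm]; exact h.lt_ord b hb.1)
  simpa using this

/-- Suppose that positivity of a set is tested by the sets `{a | rel (cls (π a) g) a}`, and that
each `a` satisfies `rel s a` for at most `ν` many `s`. Then every slice rank on a positive set can
be strictly lowered on a positive subset. -/
theorem IsSliceRank.exists_lt {ν : Cardinal.{v}} (hν : ℵ₀ ≤ ν) {Pos : Set α → Prop}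
    {cls : β → γ → δ} {rel : δ → α → Prop}
    (pos_rel : ∀ T, Pos T → ∀ g, Pos {a ∈ T | rel (cls (π a) g) a})
    (pos_of_rel : ∀ T, Pos T → ∀ T' ⊆ T, (∀ g, ∃ a ∈ T', rel (cls (π a) g) a) → Pos T')
    (pos_large : ∀ T, Pos T → Pos {a ∈ T | ν ≤ #{b ∈ T | π b = π a}})
    (mk_rel : ∀ T, Pos T → ∀ a ∈ T, #{s | rel s a} ≤ ν)
    {T : Set α} (hT : Pos T) {r : α → Cardinal.{v} × Ordinal.{v}} (hr : IsSliceRank π T r) :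
    ∃ T' ⊆ T, Pos T' ∧ ∃ r', IsSliceRank π T' r' ∧
      ∀ a ∈ T', Prod.Lex (· < ·) (· < ·) (r' a) (r a) := by
  classical
  -- If slices can be shrunk below their bound, the first coordinate drops. Otherwise every positive
  -- subset of `T` has a slice as large as its bound, and the second coordinate will be lowered.
  by_cases hcase : ∃ T' ⊆ T, Pos T' ∧ ∀ a ∈ T', #{b ∈ T' | π b = π a} < (r a).1
  · obtain ⟨T', hT', hpos, hlt⟩ := hcase
    obtain ⟨r', hr', hr'1⟩ := exists_isSliceRank π T'
    refine ⟨T', hT', hpos, r', hr', fun a ha => ?_⟩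
    rw [Prod.lex_def]
    exact Or.inl (by rw [hr'1]; exact hlt a ha)
  push Not at hcase
  -- `G x` collects the tests passed somewhere on the slice over `x`. On a slice of size at least
  -- `ν` there are at most as many as elements, so they can be numbered below the rank bound.
  let G : β → Set δ := fun x => {s | ∃ a ∈ T, π a = x ∧ rel s a}
  have hG : ∀ a ∈ T, ν ≤ #{b ∈ T | π b = π a} → #(G (π a)) ≤ (r a).1 := by
    intro a ha hν'
    have h1 : G (π a) ⊆ ⋃ b : {b ∈ T | π b = π a}, {s | rel s b.1} := by
      rintro s ⟨b, hb, hba, hs⟩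
      exact mem_iUnion.2 ⟨⟨b, hb, hba⟩, hs⟩
    calc #(G (π a)) ≤ _ := Cardinal.mk_le_mk_of_subset h1
      _ ≤ _ := Cardinal.mk_iUnion_le _
      _ ≤ #{b ∈ T | π b = π a} * ν := by
          gcongr
          exact ciSup_le' fun b => mk_rel T hT _ b.2.1
      _ ≤ #{b ∈ T | π b = π a} * #{b ∈ T | π b = π a} := by gcongr
      _ = #{b ∈ T | π b = π a} := Cardinal.mul_eq_self (hν.trans hν')
      _ ≤ _ := hr.mk_slice_le ha
  have hc : ∀ x, ∃ c : δ → Ordinal.{v}, InjOn c (G x) ∧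
      ∀ a ∈ T, π a = x → ν ≤ #{b ∈ T | π b = x} → ∀ s ∈ G x, c s < (r a).1.ord := by
    intro x
    by_cases hx : ∃ a ∈ T, π a = x ∧ ν ≤ #{b ∈ T | π b = x}
    · obtain ⟨a, ha, rfl, hν'⟩ := hx
      obtain ⟨c, hc, hc'⟩ := exists_injOn_lt_ord _ (hG a ha hν')
      refine ⟨c, hc, fun b hb hba _ s hs => ?_⟩
      rw [hr.fst_eq b hb a ha hba]
      exact hc' s hs
    · obtain ⟨c, hc, -⟩ := exists_injOn_lt_ord (G x) le_rfl
      exact ⟨c, hc, fun a ha hax h => absurd ⟨a, ha, hax, h⟩ hx⟩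
  choose c hcinj hclt using hc
  have hB : ∀ x s, ∃ b : α, (∃ b ∈ T, π b = x ∧ rel s b ∧ c x s < (r b).2) →
      b ∈ T ∧ π b = x ∧ rel s b ∧ c x s < (r b).2 := by
    intro x s
    by_cases h : ∃ b ∈ T, π b = x ∧ rel s b ∧ c x s < (r b).2
    · obtain ⟨b, hb⟩ := h
      exact ⟨b, fun _ => hb⟩
    · obtain ⟨a, -⟩ : T.Nonempty := by
        obtain ⟨a, ha, -⟩ := hcase T Subset.rfl hT
        exact ⟨a, ha⟩
      exact ⟨a, fun h' => absurd h' h⟩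
  choose B hB using hB
  -- Each test `s` contributes at most the one element `B x s`, whose new rank is the number of `s`.
  -- Injectivity of the new rank on slices follows, since `s` determines the element.
  let T' : Set α := {b ∈ T | ∃ s, rel s b ∧ B (π b) s = b ∧ c (π b) s < (r b).2}
  have hs : ∀ b, ∃ s, b ∈ T' → rel s b ∧ B (π b) s = b ∧ c (π b) s < (r b).2 := by
    intro b
    by_cases h : b ∈ T'
    · exact ⟨h.2.choose, fun _ => h.2.choose_spec⟩
    · obtain ⟨a, ha, -⟩ := hcase T Subset.rfl hT
      obtain ⟨g⟩ : Nonempty δ := by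
        by_contra hne
        have := pos_of_rel T hT ∅ (empty_subset _) (fun g => absurd ⟨cls (π a) g⟩ hne)
        obtain ⟨a, ha, -⟩ := hcase ∅ (empty_subset _) this
        exact ha
      exact ⟨g, fun h' => absurd h' h⟩
  choose s hs using hs
  refine ⟨T', fun b hb => hb.1, ?_, fun b => ((r b).1, c (π b) (s b)), ⟨?_, ?_, ?_⟩, ?_⟩
  · refine pos_of_rel T hT _ (fun b hb => hb.1) fun g => ?_
    -- By `hcase`, the elements of large slices that pass the test `g` fill some slice up to its
    -- bound. That bound is an infinite cardinal and the old ranks are injective, so fewer elements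
    -- than the bound have rank at most the number of the test; some passing element therefore has
    -- larger rank.
    obtain ⟨a, ha, hle⟩ := hcase _ (fun a ha => ha.1.1) (pos_rel _ (pos_large T hT) g)
    set x := π a with hx
    have hsG : cls x g ∈ G x := ⟨a, ha.1.1, rfl, ha.2⟩
    have hclt' := hclt x a ha.1.1 rfl ha.1.2 _ hsG
    have hinf : ℵ₀ ≤ (r a).1 := (hν.trans ha.1.2).trans (hr.mk_slice_le ha.1.1)
    have hex : ∃ b ∈ T, π b = x ∧ rel (cls x g) b ∧ c x (cls x g) < (r b).2 := by
      by_contra! hno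
      have h1 := mk_le_of_lt_ord
        (S := {b ∈ {a ∈ {a ∈ T | ν ≤ #{b ∈ T | π b = π a}} | rel (cls (π a) g) a} | π b = x})
        (f := fun b => (r b).2) (o := Order.succ (c x (cls x g)))
        (fun b hb d hd hbd => hr.inj b hb.1.1.1 d hd.1.1.1 (hb.2.trans hd.2.symm) hbd)
        (fun b hb => Order.lt_succ_of_le (hno b hb.1.1.1 hb.2 (hb.2 ▸ hb.1.2)))
      have h2 : Order.succ (c x (cls x g)) < (r a).1.ord :=
        (Cardinal.isSuccLimit_ord hinf).succ_lt hclt'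
      exact absurd (hle.trans h1) (not_le.2 (Cardinal.lt_ord.1 h2))
    obtain ⟨hb1, hb2, hb3, hb4⟩ := hB _ _ hex
    refine ⟨B x (cls x g), ⟨hb1, cls x g, hb3, ?_, ?_⟩, ?_⟩ <;> rw [hb2] <;> assumption
  · exact fun a ha b hb hab => hr.fst_eq a ha.1 b hb.1 hab
  · intro a ha b hb hab h
    have ha' := hs a ha
    have hb' := hs b hb
    simp only [hab] at h
    have := hcinj (π b) ⟨a, ha.1, hab, ha'.1⟩ ⟨b, hb.1, rfl, hb'.1⟩ h
    rw [← ha'.2.1, ← hb'.2.1, this, hab]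
  · exact fun a ha => (hs a ha).2.2.trans (hr.lt_ord a ha.1)
  · exact fun a ha => Prod.lex_def.2 (Or.inr ⟨rfl, (hs a ha).2.2⟩)

end Descent

/-! ### From rank descent to nowhere precipitousness. -/

section Precipitous

variable {κ lam : Cardinal.{u}} {J : Set (Set (Set Ordinal.{u}))}

/-- A predicate that is dense among the positive sets holds on all members of some maximal almost
disjoint family. -/
theorem exists_isMaxAlmostDisjoint (hJ : ∀ A ∈ J, ∀ B, B ⊆ A → B ∈ J)
    (P : Set (Set Ordinal.{u}) → Prop)
    (hP : ∀ C ∈ positive κ lam J, ∃ B ⊆ C, B ∈ positive κ lam J ∧ P B) :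
    ∃ Q, IsMaxAlmostDisjoint κ lam J Q ∧ ∀ B ∈ Q, P B := by
  let F : Set (Set (Set (Set Ordinal.{u}))) :=
    {Q | (∀ B ∈ Q, B ∈ positive κ lam J ∧ P B) ∧ ∀ A ∈ Q, ∀ B ∈ Q, A ≠ B → A ∩ B ∈ J}
  obtain ⟨Q, hQ⟩ : ∃ Q, Maximal (· ∈ F) Q := by
    refine zorn_subset F fun c hc hchain => ⟨⋃₀ c, ⟨?_, ?_⟩, fun s hs => subset_sUnion_of_mem hs⟩
    · rintro B ⟨Q, hQ, hB⟩
      exact (hc hQ).1 B hB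
    · rintro A ⟨Q, hQ, hA⟩ B ⟨R, hR, hB⟩ hne
      rcases hchain.total hQ hR with h | h
      · exact (hc hR).2 A (h hA) B hB hne
      · exact (hc hQ).2 A hA B (h hB) hne
  refine ⟨Q, ⟨fun B hB => (hQ.prop.1 B hB).1, hQ.prop.2, fun C hC => ?_⟩,
    fun B hB => (hQ.prop.1 B hB).2⟩
  by_contra! hno
  obtain ⟨B, hBC, hB, hPB⟩ := hP C hC
  have hJQ : ∀ A ∈ Q, A ∩ B ∈ J := fun A hA => by
    by_contra hAB
    exact hno A hA ⟨fun x hx => hC.1 hx.2,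
      fun hAC => hAB (hJ _ hAC _ (inter_subset_inter_right A hBC))⟩
  have hins : insert B Q ∈ F := by
    refine ⟨?_, ?_⟩
    · rintro D (rfl | hD)
      · exact ⟨hB, hPB⟩
      · exact hQ.prop.1 D hD
    · rintro D (rfl | hD) E (rfl | hE) hne
      · exact absurd rfl hne
      · rw [inter_comm]; exact hJQ E hE
      · exact hJQ D hD
      · exact hQ.prop.2 D hD E hE hne
  have hBQ : B ∈ Q := hQ.le_of_ge hins (subset_insert _ _) (mem_insert _ _)
  exact hB.2 (by simpa using hJQ B hBQ)

/-- If positive sets carry ranks in a well-founded order that can always be strictly lowered on a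
positive subset, then the ideal is nowhere precipitous. -/
theorem isNowherePrecipitous_of_exists_lt {W : Type*} {lt : W → W → Prop} (wf : WellFounded lt)
    (hJ : ∀ A ∈ J, ∀ B, B ⊆ A → B ∈ J)
    (Valid : Set (Set Ordinal.{u}) → (Set Ordinal.{u} → W) → Prop)
    (mono : ∀ T T' r, T' ⊆ T → Valid T r → Valid T' r)
    (exists_rank : ∀ T ∈ positive κ lam J, ∃ r, Valid T r)
    (step : ∀ T ∈ positive κ lam J, ∀ r, Valid T r →
      ∃ T' ⊆ T, T' ∈ positive κ lam J ∧ ∃ r', Valid T' r' ∧ ∀ a ∈ T', lt (r' a) (r a)) :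
    IsNowherePrecipitous κ lam J := by
  classical
  intro A hA hprec
  set K := restrict κ lam J A with hK
  have hKK : restrict κ lam K A = K := by
    ext B
    simp only [hK, restrict, mem_ofPred_eq, inter_assoc, inter_self]
    exact ⟨fun h => ⟨h.1, h.2.2⟩, fun h => ⟨h.1, inter_subset_left.trans h.1, h.2⟩⟩
  have hKdown : ∀ B ∈ K, ∀ C, C ⊆ B → C ∈ K := fun B hB C hC =>
    ⟨hC.trans hB.1, hJ _ hB.2 _ (inter_subset_inter_left A hC)⟩
  have hpos : ∀ B ⊆ A, B ∈ positive κ lam J → B ∈ positive κ lam K := fun B hBA hB =>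
    ⟨hB.1, fun h => hB.2 (by have := h.2; rwa [inter_eq_left.2 hBA] at this)⟩
  have hpos' : ∀ B ∈ positive κ lam K, B ∩ A ∈ positive κ lam J := fun B hB =>
    ⟨inter_subset_left.trans hB.1, fun h => hB.2 ⟨hB.1, h⟩⟩
  -- A stage of the construction: a maximal almost disjoint family below `A`, with a valid rank
  -- attached to each member.
  let State := {p : Set (Set (Set Ordinal.{u})) ×
      (Set (Set Ordinal.{u}) → Set Ordinal.{u} → W) //
    IsMaxAlmostDisjoint κ lam K p.1 ∧ ∀ C ∈ p.1, C ⊆ A ∧ Valid C (p.2 C)}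
  have build : ∀ P : Set (Set Ordinal.{u}) → (Set Ordinal.{u} → W) → Prop,
      (∀ C ∈ positive κ lam J, C ⊆ A → ∃ B ⊆ C, B ∈ positive κ lam J ∧ ∃ r, P B r ∧ Valid B r) →
      ∃ p : State, ∀ C ∈ p.1.1, P C (p.1.2 C) := by
    intro P hP
    obtain ⟨Q, hQ, hQP⟩ := exists_isMaxAlmostDisjoint (κ := κ) (lam := lam) (J := K) hKdown
      (fun B => B ⊆ A ∧ ∃ r, P B r ∧ Valid B r) (fun C hC => by
        obtain ⟨B, hB, hBpos, hr⟩ := hP (C ∩ A) (hpos' C hC) inter_subset_right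
        exact ⟨B, hB.trans inter_subset_left, hpos B (hB.trans inter_subset_right) hBpos,
          hB.trans inter_subset_right, hr⟩)
    have : Nonempty (Set Ordinal.{u} → W) := ⟨(exists_rank A hA).choose⟩
    choose! r hr using fun B hB => (hQP B hB).2
    exact ⟨⟨(Q, r), hQ, fun C hC => ⟨(hQP C hC).1, (hr C hC).2⟩⟩, fun C hC => (hr C hC).1⟩
  have next : ∀ p : State, ∃ q : State, ∀ C ∈ q.1.1, ∃ B ∈ p.1.1, C ⊆ B ∧
      ∀ a ∈ C, lt (q.1.2 C a) (p.1.2 B a) := by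
    intro p
    refine build (fun C r => ∃ B ∈ p.1.1, C ⊆ B ∧ ∀ a ∈ C, lt (r a) (p.1.2 B a))
      fun C hC hCA => ?_
    obtain ⟨B, hB, hBC⟩ := p.2.1.maximal C (hpos C hCA hC)
    have hBA := (p.2.2 B hB).1
    have h1 : B ∩ C ∈ positive κ lam J := by
      have := hpos' _ hBC
      rwa [inter_eq_left.2 (inter_subset_left.trans hBA)] at this
    obtain ⟨T, hT, hTpos, r, hr, hlt⟩ := step _ h1 _
      (mono _ _ _ inter_subset_left (p.2.2 B hB).2)
    exact ⟨T, hT.trans inter_subset_right, hTpos, r,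
      ⟨B, hB, hT.trans inter_subset_left, hlt⟩, hr⟩
  obtain ⟨p₀, -⟩ := build (fun _ _ => True) fun C hC _ => by
    obtain ⟨r, hr⟩ := exists_rank C hC
    exact ⟨C, Subset.rfl, hC, r, trivial, hr⟩
  choose nx hnx using next
  let p : ℕ → State := fun n => Nat.rec p₀ (fun _ q => nx q) n
  have hp : ∀ n, ∀ C ∈ (p (n + 1)).1.1, ∃ B ∈ (p n).1.1, C ⊆ B ∧
      ∀ a ∈ C, lt ((p (n + 1)).1.2 C a) ((p n).1.2 B a) := fun n => hnx (p n)
  obtain ⟨f, hf, hdec, a, ha⟩ := hprec A (hpos A Subset.rfl hA) (fun n => (p n).1.1)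
    (fun n => by rw [hKK]; exact (p n).2.1)
    (fun n C hC => let ⟨B, hB, hCB, _⟩ := hp n C hC; ⟨B, hB, hCB⟩)
  have hlt : ∀ n, lt ((p (n + 1)).1.2 (f (n + 1)) a) ((p n).1.2 (f n) a) := by
    intro n
    obtain ⟨B, hB, hCB, h⟩ := hp n _ (hf (n + 1))
    have hBf : B = f n := by
      -- The member of level `n` above `f (n + 1)` chosen by the construction must be `f n`: two
      -- distinct members have negligible intersection, while both contain the positive set `f (n +
      -- 1)`.
      by_contra hne
      exact ((p (n + 1)).2.1.subset_positive (hf (n + 1))).2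
        (hKdown _ ((p n).2.1.inter_mem B hB _ (hf n) hne) _ (subset_inter hCB (hdec n)))
    rw [← hBf]
    exact h a (mem_iInter.1 ha (n + 1))
  exact (wellFounded_iff_isEmpty_descending_chain.1 wf).elim ⟨fun n => (p n).1.2 (f n) a, hlt⟩

end Precipitous

/-! ### Basic properties of normal ideals on `P_κ(λ)`. -/

section Ideals

variable {κ lam θ : Cardinal.{u}} {J : Set (Set (Set Ordinal.{u}))}

theorem PK_mono {a b : Set Ordinal.{u}} (hb : b ∈ PK κ lam) (h : a ⊆ b) : a ∈ PK κ lam :=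
  ⟨h.trans hb.1, (Cardinal.mk_le_mk_of_subset h).trans_lt hb.2⟩

theorem aleph0_lt_lift (hκ₀ : ℵ₀ < κ) : ℵ₀ < Cardinal.lift.{u + 1} κ := by
  rwa [← Cardinal.lift_aleph0.{u + 1, u}, Cardinal.lift_lt]

theorem finite_mem_PK (hκ₀ : ℵ₀ < κ) {a : Set Ordinal.{u}} (ha : a.Finite)
    (h : a ⊆ Iio lam.ord) : a ∈ PK κ lam :=
  ⟨h, ha.lt_aleph0.trans (aleph0_lt_lift hκ₀)⟩

theorem singleton_mem_PK (hκ₀ : ℵ₀ < κ) {ξ : Ordinal.{u}} (h : ξ < lam.ord) :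
    {ξ} ∈ PK κ lam :=
  finite_mem_PK hκ₀ (finite_singleton ξ) (singleton_subset_iff.2 h)

theorem biUnion_mem_PK {ι : Type (u + 1)} (hκ : κ.IsRegular) {s : Set ι}
    (hs : #s < Cardinal.lift.{u + 1} κ) {t : ι → Set Ordinal.{u}}
    (ht : ∀ i ∈ s, t i ∈ PK κ lam) : ⋃ i ∈ s, t i ∈ PK κ lam := by
  refine ⟨iUnion₂_subset fun i hi => (ht i hi).1, ?_⟩
  exact (Cardinal.card_biUnion_lt_iff_forall_of_isRegular (t := fun i _ => t i) hκ.lift hs).2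
    fun i hi => (ht i hi).2

theorem union_mem_PK (hκ₀ : ℵ₀ < κ) {a b : Set Ordinal.{u}} (ha : a ∈ PK κ lam)
    (hb : b ∈ PK κ lam) : a ∪ b ∈ PK κ lam :=
  ⟨union_subset ha.1 hb.1, (Cardinal.mk_union_le a b).trans_lt
    (Cardinal.add_lt_of_lt (aleph0_lt_lift hκ₀).le ha.2 hb.2)⟩

theorem IsIdealOn.union_mem (hJ : IsIdealOn κ lam J) (hκ₀ : ℵ₀ < κ) {A B : Set (Set Ordinal.{u})}
    (hA : A ∈ J) (hB : B ∈ J) : A ∪ B ∈ J := by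
  rw [← sUnion_pair]
  refine hJ.sUnion_mem _ (by rintro _ (rfl | rfl) <;> assumption) ?_
  exact ((finite_singleton B).insert A).lt_aleph0.trans (aleph0_lt_lift hκ₀)

/-- Removing a set of the ideal keeps positivity. -/
theorem IsIdealOn.positive_of_subset_union (hJ : IsIdealOn κ lam J) (hκ₀ : ℵ₀ < κ)
    {A B C : Set (Set Ordinal.{u})} (hA : A ∈ positive κ lam J) (hB : B ∈ J) (hC : C ⊆ A)
    (h : A ⊆ C ∪ B) : C ∈ positive κ lam J :=
  ⟨hC.trans hA.1, fun hCJ => hA.2 (hJ.downward _ (hJ.union_mem hκ₀ hCJ hB) _ h)⟩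

theorem IsIdealOn.not_cone_mem (hJ : IsIdealOn κ lam J) {b : Set Ordinal.{u}}
    (hb : b ∈ PK κ lam) : {a ∈ PK κ lam | ¬ b ⊆ a} ∈ J :=
  hJ.noncofinal_subset ⟨fun _ h => h.1, b, hb, by
    ext a; simp only [mem_ofPred_eq, mem_empty_iff_false, iff_false]; tauto⟩

theorem IsIdealOn.cone_positive (hJ : IsIdealOn κ lam J) (hκ₀ : ℵ₀ < κ)
    {A : Set (Set Ordinal.{u})} (hA : A ∈ positive κ lam J) {b : Set Ordinal.{u}}
    (hb : b ∈ PK κ lam) : {a ∈ A | b ⊆ a} ∈ positive κ lam J :=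
  hJ.positive_of_subset_union hκ₀ hA (hJ.not_cone_mem hb) (fun _ h => h.1) fun a ha => by
    by_cases h : b ⊆ a
    · exact Or.inl ⟨ha, h⟩
    · exact Or.inr ⟨hA.1 ha, h⟩

theorem IsIdealOn.exists_superset (hJ : IsIdealOn κ lam J)
    {A : Set (Set Ordinal.{u})} (hA : A ∈ positive κ lam J) {b : Set Ordinal.{u}}
    (hb : b ∈ PK κ lam) : ∃ a ∈ A, b ⊆ a := by
  by_contra! h
  exact hA.2 (hJ.downward _ (hJ.not_cone_mem hb) _ fun a ha => ⟨hA.1 ha, h a ha⟩)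

/-- This makes singletons admissible values in the definition of normality: once `0, 1 ∈ a`, they
have fewer than `|a ∩ θ|` elements. -/
theorem two_le_mk_inter (hθ : 2 ≤ θ) {a : Set Ordinal.{u}} (h : {0, 1} ⊆ a) :
    2 ≤ #(a ∩ Iio θ.ord : Set Ordinal.{u}) := by
  have h2 : ((2 : ℕ) : Ordinal.{u}) ≤ θ.ord := by
    rw [← Cardinal.ord_natCast]; exact Cardinal.ord_le_ord.2 (by exact_mod_cast hθ)
  have hsub : ({0, 1} : Set Ordinal.{u}) ⊆ a ∩ Iio θ.ord := by
    refine subset_inter h ?_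
    rintro _ (rfl | rfl)
    · exact lt_of_lt_of_le (by exact_mod_cast Nat.zero_lt_two : (0 : Ordinal.{u}) < (2 : ℕ)) h2
    · exact lt_of_lt_of_le (by exact_mod_cast Nat.one_lt_two : (1 : Ordinal.{u}) < (2 : ℕ)) h2
  refine le_trans ?_ (Cardinal.mk_le_mk_of_subset hsub)
  rw [Cardinal.mk_insert (by simp), Cardinal.mk_singleton]
  norm_num

theorem pair_mem_PK (hκ₀ : ℵ₀ < κ) (hlam : κ ≤ lam) : {0, 1} ∈ PK κ lam := by
  have h2 : ω ≤ lam.ord := by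
    rw [← Cardinal.ord_aleph0]; exact Cardinal.ord_le_ord.2 (hκ₀.le.trans hlam)
  refine finite_mem_PK hκ₀ ((finite_singleton _).insert _) ?_
  rintro _ (rfl | rfl)
  · exact lt_of_lt_of_le omega0_pos h2
  · exact lt_of_lt_of_le one_lt_omega0 h2

/-- The pressing-down lemma for `[λ]^{<θ}`-normal ideals, `θ ≥ 2`. -/
theorem IsNormalIdeal.exists_const_ordinal (hJ : IsNormalIdeal κ lam lam θ J) (hκ₀ : ℵ₀ < κ)
    (hlam : κ ≤ lam) (hθ : 2 ≤ θ) {A : Set (Set Ordinal.{u})} (hA : A ∈ positive κ lam J)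
    (f : Set Ordinal.{u} → Ordinal.{u}) (hf : ∀ a ∈ A, f a ∈ a) :
    ∃ B ∈ positive κ lam J, B ⊆ A ∧ ∃ ξ, ∀ a ∈ B, f a = ξ := by
  obtain ⟨B, hB, hBA, e, he⟩ := hJ.exists_const _
    (hJ.cone_positive hκ₀ hA (pair_mem_PK hκ₀ hlam)) (fun a => {f a}) (fun a ha => by
      refine ⟨singleton_subset_iff.2 ⟨hf a ha.1, (hA.1 ha.1).1 (hf a ha.1)⟩, ?_⟩
      rw [Cardinal.mk_singleton]
      exact lt_of_lt_of_le (by norm_num) (two_le_mk_inter hθ ha.2))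
  obtain ⟨a₀, ha₀⟩ : B.Nonempty := by
    obtain ⟨a, ha, -⟩ := hJ.exists_superset hB (pair_mem_PK hκ₀ hlam)
    exact ⟨a, ha⟩
  refine ⟨B, hB, fun a ha => (hBA ha).1, f a₀, fun a ha => ?_⟩
  have := (he a ha).trans (he a₀ ha₀).symm
  exact singleton_injective this

/-- Normal ideals are closed under diagonal unions. -/
theorem IsNormalIdeal.diag_mem (hJ : IsNormalIdeal κ lam lam θ J) (hκ₀ : ℵ₀ < κ)
    (hlam : κ ≤ lam) (hθ : 2 ≤ θ) {Z : Ordinal.{u} → Set (Set Ordinal.{u})}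
    (hZ : ∀ ξ < lam.ord, Z ξ ∈ J) : {a ∈ PK κ lam | ∃ ξ ∈ a, a ∈ Z ξ} ∈ J := by
  by_contra hno
  have hA : {a ∈ PK κ lam | ∃ ξ ∈ a, a ∈ Z ξ} ∈ positive κ lam J := ⟨fun _ h => h.1, hno⟩
  choose! f hf hf' using fun a (ha : a ∈ {a ∈ PK κ lam | ∃ ξ ∈ a, a ∈ Z ξ}) => ha.2
  obtain ⟨B, hB, hBA, ξ, hξ⟩ := hJ.exists_const_ordinal hκ₀ hlam hθ hA f hf
  obtain ⟨a, ha, -⟩ := hJ.exists_superset hB (pair_mem_PK hκ₀ hlam)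
  have hlt : ξ < lam.ord := by
    rw [← hξ a ha]
    exact (hB.1 ha).1 (hf a (hBA ha))
  exact hB.2 (hJ.downward _ (hZ ξ hlt) _ fun a ha => hξ a ha ▸ hf' a (hBA ha))

/-- The sets not closed under a function into `P_κ(λ)` belong to every normal ideal. -/
theorem IsNormalIdeal.not_closed_mem (hJ : IsNormalIdeal κ lam lam θ J) (hκ₀ : ℵ₀ < κ)
    (hlam : κ ≤ lam) (hθ : 2 ≤ θ) {g : Ordinal.{u} → Set Ordinal.{u}}
    (hg : ∀ ξ < lam.ord, g ξ ∈ PK κ lam) : {a ∈ PK κ lam | ∃ ξ ∈ a, ¬ g ξ ⊆ a} ∈ J :=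
  hJ.downward _ (hJ.diag_mem hκ₀ hlam hθ (Z := fun ξ => {a ∈ PK κ lam | ¬ g ξ ⊆ a})
    fun ξ hξ => hJ.not_cone_mem (hg ξ hξ)) _
    fun _ ⟨ha, ξ, hξ, h⟩ => ⟨ha, ξ, hξ, ha, h⟩

/-- Diagonal unions indexed by `P_{|a ∩ θ|}(a)`. -/
theorem IsNormalIdeal.small_diag_mem (hJ : IsNormalIdeal κ lam lam θ J) (hκ₀ : ℵ₀ < κ)
    (hlam : κ ≤ lam) {Z : Set Ordinal.{u} → Set (Set Ordinal.{u})}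
    (hZ : ∀ e ∈ PK κ lam, Z e ∈ J) :
    {a ∈ PK κ lam | ∃ e ∈ smallSubsets #(a ∩ Iio θ.ord : Set Ordinal.{u}) a, a ∈ Z e} ∈ J := by
  by_contra hno
  set A := {a ∈ PK κ lam | ∃ e ∈ smallSubsets #(a ∩ Iio θ.ord : Set Ordinal.{u}) a, a ∈ Z e}
    with hAdef
  have hA : A ∈ positive κ lam J := ⟨fun _ h => h.1, hno⟩
  choose! f hf hf' using fun a (ha : a ∈ A) => ha.2
  obtain ⟨B, hB, hBA, e, he⟩ := hJ.exists_const A hA f fun a ha =>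
    ⟨subset_inter (hf a ha).1 ((hf a ha).1.trans ha.1.1), (hf a ha).2⟩
  obtain ⟨a, ha, -⟩ := hJ.exists_superset hB (pair_mem_PK hκ₀ hlam)
  have hePK : e ∈ PK κ lam := by
    rw [← he a ha]
    exact PK_mono (hB.1 ha) (hf a (hBA ha)).1
  exact hB.2 (hJ.downward _ (hZ e hePK) _ fun a ha => he a ha ▸ hf' a (hBA ha))

end Ideals

/-! ### Projecting normal ideals to smaller `τ`. -/

section Projection

variable {κ lam τ θ : Cardinal.{u}} {J : Set (Set (Set Ordinal.{u}))}

theorem inter_mem_PK {a : Set Ordinal.{u}} (ha : a ∈ PK κ lam) :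
    a ∩ Iio τ.ord ∈ PK κ τ :=
  ⟨inter_subset_right, (Cardinal.mk_le_mk_of_subset inter_subset_left).trans_lt ha.2⟩

theorem PK_subset_PK (h : τ ≤ lam) : PK κ τ ⊆ PK κ lam := fun _ ha =>
  ⟨ha.1.trans (Iio_subset_Iio (Cardinal.ord_le_ord.2 h)), ha.2⟩

theorem inter_Iio_inter_Iio (h : θ ≤ τ) (a : Set Ordinal.{u}) :
    a ∩ Iio τ.ord ∩ Iio θ.ord = a ∩ Iio θ.ord := by
  rw [inter_assoc, inter_eq_right.2 (Iio_subset_Iio (Cardinal.ord_le_ord.2 h))]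

/-- The projection of a normal ideal on `P_κ(λ)` to `P_κ(τ)` is normal. -/
theorem IsNormalIdeal.projection (hJ : IsNormalIdeal κ lam lam θ J) (hθτ : θ ≤ τ) (hτ : τ ≤ lam) :
    IsNormalIdeal κ τ τ θ
      {B | B ⊆ PK κ τ ∧ {a ∈ PK κ lam | a ∩ Iio τ.ord ∈ B} ∈ J} := by
  refine ⟨⟨fun A hA => hA.1, ?_, ?_, ?_, ?_⟩, ?_⟩
  · rintro B ⟨hB, b, hb, hbB⟩
    refine ⟨hB, hJ.downward _ (hJ.not_cone_mem (PK_subset_PK hτ hb)) _ ?_⟩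
    rintro a ⟨ha, haB⟩
    refine ⟨ha, fun hba => ?_⟩
    have : a ∩ Iio τ.ord ∈ {a ∈ B | b ⊆ a} := ⟨haB, subset_inter hba hb.1⟩
    rw [hbB] at this
    exact this
  · rintro ⟨-, h⟩
    refine hJ.PK_notMem (hJ.downward _ h _ fun a ha => ⟨ha, inter_mem_PK ha⟩)
  · exact fun A hA B hB => ⟨hB.trans hA.1, hJ.downward _ hA.2 _ fun a ha => ⟨ha.1, hB ha.2⟩⟩
  · intro X hX hcard
    refine ⟨sUnion_subset fun A hA => (hX hA).1, ?_⟩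
    have := hJ.sUnion_mem ((fun B => {a ∈ PK κ lam | a ∩ Iio τ.ord ∈ B}) '' X)
      (by rintro _ ⟨B, hB, rfl⟩; exact (hX hB).2) (Cardinal.mk_image_le.trans_lt hcard)
    refine hJ.downward _ this _ ?_
    rintro a ⟨ha, B, hB, haB⟩
    exact ⟨_, ⟨B, hB, rfl⟩, ha, haB⟩
  · rintro B ⟨hB, hBJ⟩ f hf
    have hpos : {a ∈ PK κ lam | a ∩ Iio τ.ord ∈ B} ∈ positive κ lam J :=
      ⟨fun _ h => h.1, fun h => hBJ ⟨hB, h⟩⟩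
    obtain ⟨A, hA, hAB, e, he⟩ := hJ.exists_const _ hpos (fun a => f (a ∩ Iio τ.ord)) fun a ha => by
      have := hf _ ha.2
      rw [inter_Iio_inter_Iio hθτ] at this
      exact ⟨this.1.trans fun x hx => ⟨hx.1.1, ha.1.1 hx.1.1⟩, this.2⟩
    refine ⟨{x ∈ B | f x = e}, ⟨fun x hx => hB hx.1, fun h => hA.2 ?_⟩, fun x hx => hx.1, e,
      fun x hx => hx.2⟩
    exact hJ.downward _ h.2 _ fun a ha => ⟨hA.1 ha, (hAB ha).2, he a ha⟩

theorem preimage_mem_of_mem_NSnormal (hJ : IsNormalIdeal κ lam lam θ J) (hθτ : θ ≤ τ)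
    (hτ : τ ≤ lam) {y : Set (Set Ordinal.{u})} (hy : y ∈ NSnormal κ τ τ θ) :
    {a ∈ PK κ lam | a ∩ Iio τ.ord ∈ y} ∈ J :=
  (hy _ (hJ.projection hθτ hτ)).2

end Projection

/-! ### Cardinal arithmetic, the ladder of cardinals below `λ`, and coded generators. -/

section Arithmetic

variable {κ lam : Cardinal.{u}}

/-- If `τ ^ cf λ < λ` for all large `τ < λ`, then `λ ^ c = λ` for nonzero `c < cf λ`. -/
theorem power_le_of_lt_cof (hlam : ℵ₀ ≤ lam) (hκ : κ < lam)
    (h : ∀ τ, κ ≤ τ → τ < lam → τ ^ lam.ord.cof < lam) (hκμ : κ ≠ 0) {c : Cardinal.{u}}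
    (hc : c < lam.ord.cof) : lam ^ c ≤ lam := by
  induction c using Cardinal.inductionOn with
  | mk ι =>
  set X := lam.ord.ToType
  have hX : #X = lam := mk_ord_toType lam
  -- Fewer than `cf λ` values cannot be cofinal, so every function is bounded by some `x`.
  have hcov : (univ : Set (ι → X)) ⊆ ⋃ x : X, {f | ∀ i, f i < x} := by
    intro f _
    have hnc : ¬ IsCofinal (range f) := fun hcof => by
      have := (Order.cof_le hcof).trans Cardinal.mk_range_le
      rw [Ordinal.cof_toType] at this
      exact absurd hc (not_lt.2 this)
    simp only [IsCofinal, not_forall, not_exists, not_and, not_le] at hnc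
    obtain ⟨x, hx⟩ := hnc
    exact mem_iUnion.2 ⟨x, fun i => hx _ ⟨i, rfl⟩⟩
  have hle : ∀ x : X, #{f : ι → X | ∀ i, f i < x} ≤ lam := by
    intro x
    have h1 : #{f : ι → X | ∀ i, f i < x} ≤ #(ι → Iio x) :=
      Cardinal.mk_le_of_injective (f := fun f i => ⟨f.1 i, f.2 i⟩) fun f g hfg => by
        ext i
        have := congrFun hfg i
        exact congrArg Subtype.val this
    rw [← Cardinal.power_def] at h1
    have h2 : #(Iio x) < lam := 
      (Cardinal.mk_Iio_lt x (by rw [hX, Ordinal.type_toType])).trans_eq hX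
    calc _ ≤ #(Iio x) ^ #ι := h1
      _ ≤ max κ #(Iio x) ^ #ι := Cardinal.power_le_power_right (le_max_right _ _)
      _ ≤ max κ #(Iio x) ^ lam.ord.cof :=
        Cardinal.power_le_power_left
          ((lt_of_lt_of_le (pos_iff_ne_zero.2 hκμ) (le_max_left _ _)).ne') hc.le
      _ ≤ lam := (h _ (le_max_left _ _) (max_lt hκ h2)).le
  calc lam ^ #ι = #(ι → X) := by rw [← Cardinal.power_def, hX]
    _ = #(univ : Set (ι → X)) := Cardinal.mk_univ.symm
    _ ≤ _ := Cardinal.mk_le_mk_of_subset hcov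
    _ ≤ _ := Cardinal.mk_iUnion_le _
    _ ≤ lam * lam := by
      rw [hX]
      gcongr
      exact ciSup_le' hle
    _ = lam := Cardinal.mul_eq_self hlam

theorem thetaBar_le {θ : Cardinal.{u}} (hθ : θ ≤ κ) : thetaBar κ θ ≤ κ := by
  unfold thetaBar
  split_ifs with h
  · exact (Order.le_succ _).trans h.2.choose_spec.ge
  · exact hθ

/-- A family of cardinals below a singular `λ`, indexed by `cf λ`, whose initial ordinals bound
the members of `P_κ(λ)`. -/
theorem exists_ladder (hlam : lam.IsSingular) (hcf : κ ≤ lam.ord.cof) :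
    ∃ Λ : Ordinal.{u} → Cardinal.{u},
      (∀ j, κ ≤ Λ j ∧ lam.ord.cof ≤ Λ j ∧ Λ j < lam) ∧
      ∀ b ∈ PK κ lam, ∃ j < lam.ord.cof.ord, b ⊆ Iio (Λ j).ord := by
  classical
  obtain ⟨s, hs, hcard⟩ := Order.exists_cof_eq (Iio lam.ord)
  rw [Ordinal.cof_Iio, ← Ordinal.lift_cof] at hcard
  have hcard' : #(Iio lam.ord.cof.ord) = #s := by
    rw [Cardinal.mk_Iio_ordinal, card_ord, hcard]
  obtain ⟨e⟩ := Cardinal.eq.1 hcard'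
  -- The successor puts every ordinal below the `j`-th term of a cofinal family below `(Λ j).ord`.
  -- The maximum with `cf λ` ensures that ladder indices themselves lie below every `Λ j`.
  refine ⟨fun j => if h : j < lam.ord.cof.ord then
    max lam.ord.cof (Order.succ (e ⟨j, h⟩).1.1.card) else lam.ord.cof, fun j => ?_, ?_⟩
  · have hμ := hlam.cof_ord_lt
    by_cases h : j < lam.ord.cof.ord
    · simp only [h, dite_true]
      exact ⟨hcf.trans (le_max_left _ _), le_max_left _ _, max_lt hμ
        (hlam.isSuccLimit.succ_lt (Cardinal.lt_ord.1 (e ⟨j, h⟩).1.2))⟩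
    · simp only [h, dite_false]
      exact ⟨hcf, le_rfl, hμ⟩
  · intro b hb
    have hlt : #b < (Ordinal.lift.{u + 1} lam.ord).cof := by
      rw [← Ordinal.lift_cof]
      exact hb.2.trans_le (Cardinal.lift_le.2 hcf)
    have hsup := Ordinal.sSup_add_one_lt_of_lt_cof hlt hb.1
    obtain ⟨y, hy, hle⟩ := hs ⟨_, hsup⟩
    refine ⟨(e.symm ⟨y, hy⟩).1, (e.symm ⟨y, hy⟩).2, fun x hx => ?_⟩
    have hj : (e.symm ⟨y, hy⟩).1 < lam.ord.cof.ord := (e.symm ⟨y, hy⟩).2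
    have hey : e ⟨(e.symm ⟨y, hy⟩).1, hj⟩ = ⟨y, hy⟩ := e.apply_symm_apply _
    simp only [hj, dite_true, mem_Iio, hey]
    have h1 : x + 1 ≤ sSup ((fun x => x + 1) '' b) := by
      refine le_csSup ⟨lam.ord, ?_⟩ ⟨x, hx, rfl⟩
      rintro _ ⟨z, hz, rfl⟩
      exact Order.add_one_le_of_lt (hb.1 hz)
    have h2 : x < y.1 := (Order.lt_add_one_iff.2 le_rfl).trans_le (h1.trans hle)
    exact h2.trans ((lt_ord_succ_card _).trans_le (Cardinal.ord_le_ord.2 (le_max_right _ _)))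

/-- An ideal of reduced cofinality at most `λ` has generators coded by the ordinals below `λ`. -/
theorem exists_generators {I : Set (Set (Set Ordinal.{u}))} (hκ₀ : ℵ₀ < κ) (hI : ∅ ∈ I)
    (h : cofBar κ I ≤ Cardinal.lift.{u + 1} lam) :
    ∃ y : Ordinal.{u} → Set (Set Ordinal.{u}), (∀ ξ, y ξ ∈ I) ∧
      ∀ A ∈ I, ∃ b ∈ PK κ lam, A ⊆ ⋃ ξ ∈ b, y ξ := by
  classical
  have hne : {c | ∃ Y : Set (Set (Set Ordinal.{u})), Y ⊆ I ∧
      (∀ A ∈ I, ∃ y, y ⊆ Y ∧ #y < Cardinal.lift.{u + 1} κ ∧ A ⊆ ⋃₀ y) ∧ #Y = c}.Nonempty := by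
    refine ⟨_, I, Subset.rfl, fun A hA => ⟨{A}, singleton_subset_iff.2 hA, ?_, by simp⟩, rfl⟩
    exact (finite_singleton A).lt_aleph0.trans (aleph0_lt_lift hκ₀)
  obtain ⟨Y, hYI, hY, hcard⟩ := csInf_mem hne
  have hle : #Y ≤ #(Iio lam.ord) := by
    rw [Cardinal.mk_Iio_ordinal, card_ord, hcard]
    exact h
  obtain ⟨e⟩ := hle
  refine ⟨fun ξ => if h : ∃ A : Y, (e A).1 = ξ then h.choose.1 else ∅, fun ξ => ?_, ?_⟩
  · by_cases h : ∃ A : Y, (e A).1 = ξ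
    · simp only [h, dite_true]
      exact hYI h.choose.2
    · simp only [h, dite_false]
      exact hI
  · intro A hA
    obtain ⟨y, hyY, hycard, hAy⟩ := hY A hA
    let f : Y → Ordinal.{u} := fun A => (e A).1
    refine ⟨f '' {A | A.1 ∈ y}, ⟨?_, ?_⟩, fun a ha => ?_⟩
    · rintro _ ⟨A, -, rfl⟩
      exact (e A).2
    · refine Cardinal.mk_image_le.trans_lt (lt_of_le_of_lt ?_ hycard)
      exact Cardinal.mk_le_of_injective (f := fun A => (⟨A.1.1, A.2⟩ : y)) fun A B hAB => by
        simpa [Subtype.ext_iff] using hAB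
    · obtain ⟨B, hB, haB⟩ := hAy ha
      have hex : ∃ A : Y, (e A).1 = f ⟨B, hyY hB⟩ := ⟨_, rfl⟩
      refine mem_iUnion₂.2 ⟨f ⟨B, hyY hB⟩, ⟨_, hB, rfl⟩, ?_⟩
      simp only [hex, dite_true]
      have : hex.choose = ⟨B, hyY hB⟩ := e.injective (Subtype.ext hex.choose_spec)
      rw [this]
      exact haB

end Arithmetic

/-! ### The smallest normal ideal described by functions on `μ`. -/

section LadderIdeal

variable {κ lam μ θ : Cardinal.{u}} {J : Set (Set (Set Ordinal.{u}))}
  {Λ : Ordinal.{u} → Cardinal.{u}} {y : Ordinal.{u} → Ordinal.{u} → Set (Set Ordinal.{u})}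

/-- The `a ∈ P_κ(λ)` that bound their own small subsets by some `Λ j` with `j ∈ a`, and whose
traces on each such `Λ j` avoid the sets `y j ξ`, `ξ ∈ a`. -/
def coherentSets (κ lam μ θ : Cardinal.{u}) (Λ : Ordinal.{u} → Cardinal.{u})
    (y : Ordinal.{u} → Ordinal.{u} → Set (Set Ordinal.{u})) : Set (Set Ordinal.{u}) :=
  {a ∈ PK κ lam | {0, 1} ⊆ a ∧
    (∀ e ∈ smallSubsets #(a ∩ Iio θ.ord : Set Ordinal.{u}) a,
      ∃ j ∈ a, j < μ.ord ∧ e ⊆ Iio (Λ j).ord) ∧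
    ∀ j ∈ a, j < μ.ord → ∀ ξ ∈ a, a ∩ Iio (Λ j).ord ∉ y j ξ}

/-- The sets that, inside `D`, avoid all sets closed under some `g : μ → P_κ(λ)`. -/
def ladderIdeal (κ lam μ : Cardinal.{u}) (D : Set (Set Ordinal.{u})) :
    Set (Set (Set Ordinal.{u})) :=
  {Z | Z ⊆ PK κ lam ∧ ∃ g : Ordinal.{u} → Set Ordinal.{u}, (∀ j, g j ∈ PK κ lam) ∧
    ∀ a ∈ Z, a ∈ D → ∃ j ∈ a, j < μ.ord ∧ ¬ g j ⊆ a}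

theorem exists_mem_lt_of_mem_coherentSets (hθ : 2 ≤ θ) {a : Set Ordinal.{u}}
    (ha : a ∈ coherentSets κ lam μ θ Λ y) : ∃ j ∈ a, j < μ.ord := by
  obtain ⟨j, hj, hjμ, -⟩ := ha.2.2.1 ∅ ⟨empty_subset _, by
    rw [Cardinal.mk_eq_zero]
    exact lt_of_lt_of_le (by norm_num) (two_le_mk_inter hθ ha.2.1)⟩
  exact ⟨j, hj, hjμ⟩

/-- Each clause defining a coherent set fails only on a negligible set: the first on the complement
of a cone, the second on a diagonal union over small subsets, and the third on a double diagonal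
union of preimages of the `y j ξ`. -/
theorem diff_coherentSets_mem (hJ : IsNormalIdeal κ lam lam θ J) (hκ₀ : ℵ₀ < κ) (hlam : κ ≤ lam)
    (hθ : 2 ≤ θ) (hθκ : θ ≤ κ) (hμ : μ ≤ lam) (hΛκ : ∀ j, κ ≤ Λ j) (hΛ : ∀ j, Λ j < lam)
    (hbdd : ∀ b ∈ PK κ lam, ∃ j < μ.ord, b ⊆ Iio (Λ j).ord)
    (hy : ∀ j ξ, y j ξ ∈ NSnormal κ (Λ j) (Λ j) θ) :
    PK κ lam \ coherentSets κ lam μ θ Λ y ∈ J := by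
  have h1 := hJ.not_cone_mem (pair_mem_PK hκ₀ hlam)
  have h2 := hJ.small_diag_mem hκ₀ hlam
    (Z := fun e => {a ∈ PK κ lam | ∀ j ∈ a, j < μ.ord → ¬ e ⊆ Iio (Λ j).ord}) (fun e he => by
      obtain ⟨j, hj, hej⟩ := hbdd e he
      have hjl : j < lam.ord := hj.trans_le (Cardinal.ord_le_ord.2 hμ)
      refine hJ.downward _ (hJ.not_cone_mem (singleton_mem_PK hκ₀ hjl)) _ fun a ha => ⟨ha.1, ?_⟩
      exact fun hja => ha.2 j (hja rfl) hj hej)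
  have h3 := hJ.diag_mem hκ₀ hlam hθ (Z := fun j => {a ∈ PK κ lam | ∃ ξ ∈ a,
    a ∈ {a ∈ PK κ lam | a ∩ Iio (Λ j).ord ∈ y j ξ}}) fun j _ =>
      hJ.diag_mem hκ₀ hlam hθ fun ξ _ =>
        preimage_mem_of_mem_NSnormal hJ (hθκ.trans (hΛκ j)) (hΛ j).le (hy j ξ)
  refine hJ.downward _ (hJ.union_mem hκ₀ h1 (hJ.union_mem hκ₀ h2 h3)) _ ?_
  rintro a ⟨ha, hD⟩
  by_contra hno
  simp only [mem_union, not_or] at hno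
  refine hD ⟨ha, by_contra fun h => hno.1 ⟨ha, h⟩, fun e he => ?_, fun j hj _ ξ hξ h =>
    hno.2.2 ⟨ha, j, hj, ha, ξ, hξ, ha, h⟩⟩
  by_contra! h
  exact hno.2.1 ⟨ha, e, he, ha, h⟩

theorem ladderIdeal_subset (hJ : IsNormalIdeal κ lam lam θ J) (hκ₀ : ℵ₀ < κ) (hlam : κ ≤ lam)
    (hθ : 2 ≤ θ) {D : Set (Set Ordinal.{u})} (hD : PK κ lam \ D ∈ J) :
    ladderIdeal κ lam μ D ⊆ J := by
  rintro Z ⟨hZ, g, hg, h⟩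
  refine hJ.downward _ (hJ.union_mem hκ₀ hD
    (hJ.not_closed_mem hκ₀ hlam hθ (g := g) fun ξ _ => hg ξ)) _ fun a ha => ?_
  by_cases haD : a ∈ D
  · obtain ⟨j, hj, -, hgj⟩ := h a ha haD
    exact Or.inr ⟨hZ ha, j, hj, hgj⟩
  · exact Or.inl ⟨hZ ha, haD⟩

/-- The sets `x` with some `e ∈ P_{|x ∩ θ|}(x)` and `k ∈ x` such that `h e k` is not included in
`x` are negligible. -/
theorem not_closed_mem_NSnormal {τ : Cardinal.{u}} (hκ₀ : ℵ₀ < κ) (hτ : κ ≤ τ) (hθ : 2 ≤ θ)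
    {h : Set Ordinal.{u} → Ordinal.{u} → Set Ordinal.{u}}
    (hh : ∀ e ∈ PK κ τ, ∀ k, #(h e k) < Cardinal.lift.{u + 1} κ) :
    {x ∈ PK κ τ | ∃ e ∈ smallSubsets #(x ∩ Iio θ.ord : Set Ordinal.{u}) x,
      ∃ k ∈ x, ¬ h e k ∩ Iio τ.ord ⊆ x} ∈ NSnormal κ τ τ θ := by
  intro I hI
  have := hI.small_diag_mem hκ₀ hτ
    (Z := fun e => {x ∈ PK κ τ | ∃ k ∈ x, ¬ h e k ∩ Iio τ.ord ⊆ x}) fun e he =>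
      hI.not_closed_mem hκ₀ hτ hθ fun k _ =>
        ⟨inter_subset_right, (Cardinal.mk_le_mk_of_subset inter_subset_left).trans_lt (hh e he k)⟩
  exact hI.downward _ this _ fun x ⟨hx, e, he, k, hk, h⟩ => ⟨hx, e, he, hx, k, hk, h⟩

/-- Normality is where the generators matter. If all fibres of a regressive `F` were negligible,
their witnesses `g e` would have to be merged into one function on `μ`. At each level `j`, the
points of `P_κ(Λ j)` not closed under all the relevant `g e k` form a negligible set, and the codes
of generators covering it serve as the single value `G j`. -/
theorem isNormalIdeal_ladderIdeal (hκ : κ.IsRegular) (hκ₀ : ℵ₀ < κ)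
    (hθ : 2 ≤ θ) (hθκ : θ ≤ κ) (hΛκ : ∀ j, κ ≤ Λ j) (hΛμ : ∀ j, μ ≤ Λ j)
    (hbdd : ∀ b ∈ PK κ lam, ∃ j < μ.ord, b ⊆ Iio (Λ j).ord)
    (hgen : ∀ j, ∀ A ∈ NSnormal κ (Λ j) (Λ j) θ, ∃ b ∈ PK κ lam, A ⊆ ⋃ ξ ∈ b, y j ξ)
    (hproper : PK κ lam ∉ ladderIdeal κ lam μ (coherentSets κ lam μ θ Λ y)) :
    IsNormalIdeal κ lam lam θ (ladderIdeal κ lam μ (coherentSets κ lam μ θ Λ y)) := by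
  set D := coherentSets κ lam μ θ Λ y with hD
  refine ⟨⟨fun A hA => hA.1, ?_, hproper, ?_, ?_⟩, ?_⟩
  · rintro A ⟨hA, b, hb, hbA⟩
    refine ⟨hA, fun _ => b, fun _ => hb, fun a ha haD => ?_⟩
    obtain ⟨j, hj, hjμ⟩ := exists_mem_lt_of_mem_coherentSets hθ haD
    refine ⟨j, hj, hjμ, fun hba => ?_⟩
    have : a ∈ {a ∈ A | b ⊆ a} := ⟨ha, hba⟩
    rw [hbA] at this
    exact this
  · rintro A ⟨hA, g, hg, h⟩ B hBA
    exact ⟨hBA.trans hA, g, hg, fun a ha => h a (hBA ha)⟩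
  · intro X hX hcard
    choose! g hg h using fun A (hA : A ∈ X) => (hX hA).2
    refine ⟨sUnion_subset fun A hA => (hX hA).1, fun j => ⋃ A ∈ X, g A j,
      fun j => biUnion_mem_PK hκ hcard fun A hA => hg A hA j, ?_⟩
    rintro a ⟨A, hA, ha⟩ haD
    obtain ⟨j, hj, hjμ, hgj⟩ := h A hA a ha haD
    exact ⟨j, hj, hjμ, fun hsub => hgj ((subset_biUnion_of_mem (u := fun A => g A j) hA).trans hsub)⟩
  · rintro A ⟨hA, hAn⟩ F hF
    by_contra! hno
    have hfib : ∀ e, {a ∈ A | F a = e} ∈ ladderIdeal κ lam μ D := by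
      intro e
      by_contra hpos
      obtain ⟨a, ha, hne⟩ := hno _ ⟨fun a ha => hA ha.1, hpos⟩ (fun a ha => ha.1) e
      exact hne ha.2
    choose g hg hgF using fun e => (hfib e).2
    have hj : ∀ e k, ∃ j, e ∈ PK κ lam → j < μ.ord ∧ e ∪ g e k ⊆ Iio (Λ j).ord := by
      intro e k
      by_cases he : e ∈ PK κ lam
      · obtain ⟨j, hj⟩ := hbdd _ (union_mem_PK hκ₀ he (hg e k))
        exact ⟨j, fun _ => hj⟩
      · exact ⟨0, fun h => absurd h he⟩
    choose b hb using hj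
    -- Besides `g e k`, closure must also yield a ladder index `b e k` high enough to see all of `g
    -- e k`.
    let h : Set Ordinal.{u} → Ordinal.{u} → Set Ordinal.{u} := fun e k => g e k ∪ {b e k}
    have hh : ∀ e k, #(h e k) < Cardinal.lift.{u + 1} κ := fun e k =>
      (Cardinal.mk_union_le _ _).trans_lt (Cardinal.add_lt_of_lt (aleph0_lt_lift hκ₀).le (hg e k).2
        ((finite_singleton _).lt_aleph0.trans (aleph0_lt_lift hκ₀)))
    choose G hG hGy using fun j => hgen j _
      (not_closed_mem_NSnormal hκ₀ (hΛκ j) hθ (h := h) fun e _ k => hh e k)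
    refine hAn ⟨hA, G, hG, fun a ha haD => ?_⟩
    by_contra! hcl
    have haPK := hA ha
    have hFa := hF a ha
    have hFa' : F a ⊆ a := hFa.1.trans inter_subset_left
    have hFPK : F a ∈ PK κ lam := PK_mono haPK hFa'
    obtain ⟨k, hk, hkμ, hgk⟩ := hgF (F a) a ⟨ha, rfl⟩ haD
    have key : ∀ j ∈ a, j < μ.ord → F a ⊆ Iio (Λ j).ord →
        h (F a) k ∩ Iio (Λ j).ord ⊆ a := by
      intro j hj hjμ hFj
      by_contra hsub
      have hx : a ∩ Iio (Λ j).ord ∈ {x ∈ PK κ (Λ j) |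
          ∃ e ∈ smallSubsets #(x ∩ Iio θ.ord : Set Ordinal.{u}) x,
            ∃ k ∈ x, ¬ h e k ∩ Iio (Λ j).ord ⊆ x} := by
        refine ⟨inter_mem_PK haPK, F a, ⟨subset_inter hFa' hFj, ?_⟩, k,
          ⟨hk, hkμ.trans_le (Cardinal.ord_le_ord.2 (hΛμ j))⟩,
          fun hs => hsub (hs.trans inter_subset_left)⟩
        rw [inter_Iio_inter_Iio (hθκ.trans (hΛκ j))]
        exact hFa.2
      obtain ⟨ξ, hξ, hxξ⟩ := mem_iUnion₂.1 (hGy j hx)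
      exact haD.2.2.2 j hj hjμ ξ (hcl j hj hjμ hξ) hxξ
    -- `key` is used twice. An index `j ∈ a` bounding `F a` may be too low for `g (F a) k`, but it
    -- suffices to put `b (F a) k < μ ≤ Λ j` into `a`; at that new index all of `g (F a) k` is
    -- visible and hence included in `a`.
    obtain ⟨j, hj, hjμ, hFj⟩ := haD.2.2.1 (F a) ⟨hFa', hFa.2⟩
    have hbk := hb (F a) k hFPK
    have hba : b (F a) k ∈ a := key j hj hjμ hFj
      ⟨Or.inr rfl, hbk.1.trans_le (Cardinal.ord_le_ord.2 (hΛμ j))⟩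
    exact hgk fun η hη => key _ hba hbk.1 (subset_union_left.trans hbk.2)
      ⟨Or.inl hη, hbk.2 (Or.inr hη)⟩

/-- One inclusion holds because normal ideals contain the sets of points not closed under a
function. It also makes the ladder ideal proper, hence normal, and minimality gives the other
inclusion. -/
theorem NSnormal_eq_ladderIdeal (hex : ∃ J, IsNormalIdeal κ lam lam θ J)
    (hκ : κ.IsRegular) (hκ₀ : ℵ₀ < κ) (hlam : κ ≤ lam)
    (hθ : 2 ≤ θ) (hθκ : θ ≤ κ) (hμ : μ ≤ lam) (hΛκ : ∀ j, κ ≤ Λ j) (hΛμ : ∀ j, μ ≤ Λ j)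
    (hΛ : ∀ j, Λ j < lam)
    (hbdd : ∀ b ∈ PK κ lam, ∃ j < μ.ord, b ⊆ Iio (Λ j).ord)
    (hy : ∀ j ξ, y j ξ ∈ NSnormal κ (Λ j) (Λ j) θ)
    (hgen : ∀ j, ∀ A ∈ NSnormal κ (Λ j) (Λ j) θ, ∃ b ∈ PK κ lam, A ⊆ ⋃ ξ ∈ b, y j ξ) :
    NSnormal κ lam lam θ = ladderIdeal κ lam μ (coherentSets κ lam μ θ Λ y) := by
  have hN := (isLeast_NSnormal hex).1
  have hsub := ladderIdeal_subset (μ := μ) hN hκ₀ hlam hθ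
    (diff_coherentSets_mem hN hκ₀ hlam hθ hθκ hμ hΛκ hΛ hbdd hy)
  refine Subset.antisymm ((isLeast_NSnormal hex).2 ?_) hsub
  exact isNormalIdeal_ladderIdeal hκ hκ₀ hθ hθκ hΛκ hΛμ hbdd hgen
    fun h => hN.PK_notMem (hsub h)

end LadderIdeal

/-! ### Slices along `a ∩ μ` and the first assertion. -/

section NowherePrecipitous

variable {κ lam μ : Cardinal.{u}} {D : Set (Set Ordinal.{u})}

theorem mk_powerset_prod_le (hκμ : κ ≤ μ) (hμ : ℵ₀ ≤ μ) {a : Set Ordinal.{u}}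
    (ha : a ∈ PK κ lam) : #(𝒫 (a ×ˢ a)) ≤ Cardinal.lift.{u + 1} (2 ^ μ) := by
  have hle : #a ≤ Cardinal.lift.{u + 1} μ := ha.2.le.trans (Cardinal.lift_le.2 hκμ)
  rw [Cardinal.mk_powerset, Cardinal.mk_setProd,
    Cardinal.lift_power, Cardinal.lift_two]
  refine Cardinal.power_le_power_left two_ne_zero ?_
  calc #a * #a ≤ Cardinal.lift.{u + 1} μ * Cardinal.lift.{u + 1} μ := mul_le_mul' hle hle
    _ = _ := Cardinal.mul_eq_self (by rwa [Cardinal.aleph0_le_lift])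

/-- The union of all slices of size less than `2 ^ μ` is not cofinal. -/
theorem small_slices_noncofinal (hκ₀ : ℵ₀ < κ) (hκμ : κ ≤ μ) (h2 : 2 ^ μ < lam)
    {T : Set (Set Ordinal.{u})} (hT : T ⊆ PK κ lam) :
    {a ∈ T | #{b ∈ T | b ∩ Iio μ.ord = a ∩ Iio μ.ord} < Cardinal.lift.{u + 1} (2 ^ μ)} ∈
      noncofinal κ lam := by
  set ν := Cardinal.lift.{u + 1} (2 ^ μ) with hν
  set R := {a ∈ T | #{b ∈ T | b ∩ Iio μ.ord = a ∩ Iio μ.ord} < ν} with hR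
  have hμ : ℵ₀ ≤ μ := hκ₀.le.trans hκμ
  have hνinf : ℵ₀ ≤ ν := by
    rw [hν, Cardinal.aleph0_le_lift]
    exact hμ.trans (Cardinal.cantor μ).le
  have hRcov : R ⊆ ⋃ x ∈ 𝒫 (Iio μ.ord), {a ∈ R | a ∩ Iio μ.ord = x} := fun a ha =>
    mem_iUnion₂.2 ⟨a ∩ Iio μ.ord, inter_subset_right, ha, rfl⟩
  have hRcard : #R ≤ ν := by
    calc #R ≤ _ := Cardinal.mk_le_mk_of_subset hRcov
      _ ≤ _ := Cardinal.mk_biUnion_le _ _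
      _ ≤ ν * ν := by
        gcongr
        · rw [Cardinal.mk_powerset, Cardinal.mk_Iio_ordinal, card_ord, hν, Cardinal.lift_power,
            Cardinal.lift_two]
        · refine ciSup_le' fun x => ?_
          rcases ({a ∈ R | a ∩ Iio μ.ord = x.1} : Set (Set Ordinal.{u})).eq_empty_or_nonempty
            with h | ⟨a, ha, hax⟩
          · rw [h, Cardinal.mk_eq_zero]
            exact zero_le
          · refine le_trans (Cardinal.mk_le_mk_of_subset ?_) ha.2.le
            exact fun b hb => ⟨hb.1.1, hb.2.trans hax.symm⟩
      _ = ν := Cardinal.mul_eq_self hνinf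
  -- At most `2 ^ μ` traces with small slices leave at most `2 ^ μ` sets, whose union cannot exhaust
  -- `λ`; a missed ordinal witnesses noncofinality.
  have hU : #(⋃₀ R) < #(Iio lam.ord) := by
    calc #(⋃₀ R) ≤ _ := Cardinal.mk_sUnion_le R
      _ ≤ ν * ν := by
        gcongr
        refine ciSup_le' fun a => ((hT a.2.1).2.le.trans ?_)
        exact Cardinal.lift_le.2 (hκμ.trans (Cardinal.cantor μ).le)
      _ = ν := Cardinal.mul_eq_self hνinf
      _ < _ := by
        rw [Cardinal.mk_Iio_ordinal, card_ord]
        exact Cardinal.lift_lt.2 h2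
  obtain ⟨ξ, hξ, hξU⟩ : ∃ ξ ∈ Iio lam.ord, ξ ∉ ⋃₀ R := by
    by_contra! h
    exact absurd hU (not_lt.2 (Cardinal.mk_le_mk_of_subset h))
  refine ⟨fun a ha => hT ha.1, {ξ}, singleton_mem_PK hκ₀ hξ, ?_⟩
  ext a
  simp only [mem_ofPred_eq, singleton_subset_iff, mem_empty_iff_false, iff_false, not_and]
  exact fun ha hξa => hξU ⟨a, ha, hξa⟩

/-- The code of `g` over `x` is its graph restricted to `x`, so that closure of `a` under `g` on `a
∩ μ` becomes inclusion of a code in `a ×ˢ a`. This inclusion bounds the number of codes accepted by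
`a`. -/
theorem ladderIdeal_isNowherePrecipitous (hκ₀ : ℵ₀ < κ) (hκμ : κ ≤ μ) (h2 : 2 ^ μ < lam)
    (hI : IsIdealOn κ lam (ladderIdeal κ lam μ D)) :
    IsNowherePrecipitous κ lam (ladderIdeal κ lam μ D) := by
  have hμ : ℵ₀ ≤ μ := hκ₀.le.trans hκμ
  set π : Set Ordinal.{u} → Set Ordinal.{u} := fun a => a ∩ Iio μ.ord with hπ
  let cls : Set Ordinal.{u} → {g : Ordinal.{u} → Set Ordinal.{u} // ∀ j, g j ∈ PK κ lam} →
    Set (Ordinal.{u} × Ordinal.{u}) := fun x g => {p | p.1 ∈ x ∧ p.2 ∈ g.1 p.1}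
  let rel : Set (Ordinal.{u} × Ordinal.{u}) → Set Ordinal.{u} → Prop :=
    fun s a => a ∈ D ∧ s ⊆ a ×ˢ a
  have hrel : ∀ a g, rel (cls (π a) g) a ↔ a ∈ D ∧ ∀ j ∈ a, j < μ.ord → g.1 j ⊆ a := by
    intro a g
    refine and_congr_right fun _ => ⟨fun h j hj hjμ η hη => (h ⟨⟨hj, hjμ⟩, hη⟩ :
      (j, η) ∈ a ×ˢ a).2, ?_⟩
    rintro h ⟨j, η⟩ ⟨⟨hj, hjμ⟩, hη⟩
    exact ⟨hj, h j hj hjμ hη⟩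
  refine isNowherePrecipitous_of_exists_lt (WellFounded.prod_lex wellFounded_lt wellFounded_lt)
    hI.downward (fun T r => IsSliceRank π T r) (fun T T' r h hr => hr.mono h)
    (fun T _ => (exists_isSliceRank π T).imp fun r hr => hr.1) fun T hT r hr => ?_
  refine IsSliceRank.exists_lt (ν := Cardinal.lift.{u + 1} (2 ^ μ))
    (Pos := (· ∈ positive κ lam (ladderIdeal κ lam μ D))) (cls := cls) (rel := rel)
    ?_ ?_ ?_ ?_ ?_ hT hr
  · rw [Cardinal.aleph0_le_lift]
    exact hμ.trans (Cardinal.cantor μ).le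
  · intro T hT g
    refine hI.positive_of_subset_union hκ₀ hT
      (B := {a ∈ PK κ lam | a ∈ D → ∃ j ∈ a, j < μ.ord ∧ ¬ g.1 j ⊆ a})
      ⟨fun _ h => h.1, g.1, g.2, fun _ h => h.2⟩ (fun _ h => h.1) fun a ha => ?_
    by_cases h : rel (cls (π a) g) a
    · exact Or.inl ⟨ha, h⟩
    · refine Or.inr ⟨hT.1 ha, fun haD => ?_⟩
      rw [hrel] at h
      push Not at h
      exact h haD
  · rintro T hT T' hT' h
    refine ⟨hT'.trans hT.1, ?_⟩
    rintro ⟨-, g, hg, hno⟩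
    obtain ⟨a, ha, har⟩ := h ⟨g, hg⟩
    rw [hrel] at har
    obtain ⟨j, hj, hjμ, hgj⟩ := hno a ha har.1
    exact hgj (har.2 j hj hjμ)
  · intro T hT
    refine hI.positive_of_subset_union hκ₀ hT
      (hI.noncofinal_subset (small_slices_noncofinal hκ₀ hκμ h2 hT.1)) (fun _ h => h.1)
      fun a ha => ?_
    rcases le_or_gt (Cardinal.lift.{u + 1} (2 ^ μ)) #{b ∈ T | π b = π a} with h | h
    · exact Or.inl ⟨ha, h⟩
    · exact Or.inr ⟨ha, h⟩
  · intro T hT a ha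
    refine (Cardinal.mk_le_mk_of_subset ?_).trans (mk_powerset_prod_le hκμ hμ (hT.1 ha))
    exact fun s hs => hs.2

/-- Since `θ̄ ≤ κ ≤ cf λ`, the bound `λ ^< θ̄` on reduced cofinalities is at most `λ`, which lets
ordinals below `λ` code the generators. -/
theorem NSnormal_isNowherePrecipitous {θ : Cardinal.{u}} (hκ : κ.IsRegular) (hκ₀ : ℵ₀ < κ)
    (hlam : lam.IsSingular) (hcf : κ ≤ lam.ord.cof) (hθ : 2 ≤ θ) (hθκ : θ ≤ κ)
    (hex : ∃ J, IsNormalIdeal κ lam lam θ J)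
    (hpow : ∀ τ : Cardinal.{u}, κ ≤ τ → τ < lam → τ ^ lam.ord.cof < lam)
    (hcof : ∀ τ : Cardinal.{u}, κ ≤ τ → τ < lam →
      cofBar κ (NSnormal κ τ τ θ) ≤ Cardinal.lift.{u + 1} (lam ^< thetaBar κ θ)) :
    IsNowherePrecipitous κ lam (NSnormal κ lam lam θ) := by
  have hμ := hlam.cof_ord_lt
  have hκlam : κ < lam := hcf.trans_lt hμ
  have hle : lam ^< thetaBar κ θ ≤ lam := Cardinal.powerlt_le.2 fun c hc =>
    power_le_of_lt_cof (hκ₀.le.trans hκlam.le) hκlam hpow hκ.ne_zero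
      (hc.trans_le ((thetaBar_le hθκ).trans hcf))
  obtain ⟨Λ, hΛ, hbdd⟩ := exists_ladder hlam hcf
  choose y hy hgen using fun j => exists_generators (lam := lam)
    (I := NSnormal κ (Λ j) (Λ j) θ) hκ₀
    (fun I hI => hI.noncofinal_subset ⟨empty_subset _, ∅, finite_mem_PK hκ₀ finite_empty
      (empty_subset _), by simp⟩)
    ((hcof _ (hΛ j).1 (hΛ j).2.2).trans (Cardinal.lift_le.2 hle))
  have heq := NSnormal_eq_ladderIdeal hex hκ hκ₀ hκlam.le hθ hθκ hμ.le (fun j => (hΛ j).1)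
    (fun j => (hΛ j).2.1) (fun j => (hΛ j).2.2) hbdd hy hgen
  have hI := (isLeast_NSnormal hex).1.toIsIdealOn
  rw [heq] at hI ⊢
  refine ladderIdeal_isNowherePrecipitous hκ₀ hcf ?_ hI
  refine lt_of_le_of_lt (Cardinal.power_le_power_right ?_) (hpow κ le_rfl hκlam)
  exact_mod_cast (hκ.nat_lt 2).le

end NowherePrecipitous

/-! ### The nonstationary ideal as the smallest normal ideal for `θ = 2`, and the strong limit case.
-/

section Club

variable {κ lam : Cardinal.{u}}

theorem sUnion_mem_PK (hκ : κ.IsRegular) {X : Set (Set Ordinal.{u})} (hX : X ⊆ PK κ lam)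
    (hcard : #X < Cardinal.lift.{u + 1} κ) : ⋃₀ X ∈ PK κ lam := by
  rw [sUnion_eq_biUnion]
  exact biUnion_mem_PK hκ hcard fun a ha => hX ha

theorem mk_range_nat_lt (hκ₀ : ℵ₀ < κ) {α : Type (u + 1)} (f : ℕ → α) :
    #(range f) < Cardinal.lift.{u + 1} κ :=
  (Set.countable_range f).le_aleph0.trans_lt (aleph0_lt_lift hκ₀)

/-- Diagonal intersections of clubs along a continuous assignment `a ↦ N a` of small index sets
are clubs. -/
theorem isClubIn_diag (hκ : κ.IsRegular) (hκ₀ : ℵ₀ < κ) {ι : Type (u + 1)}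
    {N : Set Ordinal.{u} → Set ι} (hN : ∀ a ∈ PK κ lam, #(N a) < Cardinal.lift.{u + 1} κ)
    (hmono : ∀ a b, a ⊆ b → N a ⊆ N b)
    (hcont : ∀ X : Set (Set Ordinal.{u}), X.Nonempty → ∀ i ∈ N (⋃₀ X), ∃ a ∈ X, i ∈ N a)
    {C : ι → Set (Set Ordinal.{u})} (hC : ∀ i, IsClubIn κ lam (C i)) :
    IsClubIn κ lam {a ∈ PK κ lam | ∀ i ∈ N a, a ∈ C i} := by
  refine ⟨fun a ha => ha.1, fun b hb => ?_, fun X hX hne hchain hcard => ?_⟩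
  · choose! c hcC hc using fun i => (hC i).unbounded
    have hcPK : ∀ i, ∀ x ∈ PK κ lam, c i x ∈ PK κ lam := fun i x hx =>
      (hC i).subset_PK (hcC i x hx)
    let B : ℕ → Set Ordinal.{u} := fun n => Nat.rec b (fun _ x => x ∪ ⋃ i ∈ N x, c i x) n
    have hBs : ∀ n, B (n + 1) = B n ∪ ⋃ i ∈ N (B n), c i (B n) := fun n => rfl
    have hB : ∀ n, B n ∈ PK κ lam := by
      intro n
      induction n with
      | zero => exact hb
      | succ n ih =>
        rw [hBs]
        exact union_mem_PK hκ₀ ih (biUnion_mem_PK hκ (hN _ ih) fun i _ => hcPK i _ ih)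
    have hBmono : Monotone B := monotone_nat_of_le_succ fun n => by
      rw [hBs]; exact subset_union_left
    have haPK : ⋃₀ range B ∈ PK κ lam :=
      sUnion_mem_PK hκ (by rintro _ ⟨n, rfl⟩; exact hB n) (mk_range_nat_lt hκ₀ B)
    refine ⟨⋃₀ range B, ⟨haPK, fun i hi => ?_⟩, subset_sUnion_of_mem ⟨0, rfl⟩⟩
    obtain ⟨_, ⟨m, rfl⟩, him⟩ := hcont _ (range_nonempty B) i hi
    have hstep : ∀ n, c i (B (m + n)) ⊆ B (m + n + 1) := fun n => by
      rw [hBs]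
      exact (subset_biUnion_of_mem (u := fun i => c i (B (m + n)))
        (hmono _ _ (hBmono (Nat.le_add_right m n)) him)).trans subset_union_right
    have hcm : Monotone fun n => c i (B (m + n)) := monotone_nat_of_le_succ fun n =>
      (hstep n).trans (hc i _ (hB (m + (n + 1))))
    -- From stage `m` on, the sets `B n` interleave with members of `C i`, so their union is the
    -- union of a chain in `C i`.
    have heq : ⋃₀ range B = ⋃₀ range fun n => c i (B (m + n)) := by
      refine Subset.antisymm (sUnion_subset ?_) (sUnion_subset ?_)
      · rintro _ ⟨n, rfl⟩
        exact ((hBmono (Nat.le_add_left n m)).trans (hc i _ (hB (m + n)))).trans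
          (subset_sUnion_of_mem ⟨n, rfl⟩)
      · rintro _ ⟨n, rfl⟩
        exact (hstep n).trans (subset_sUnion_of_mem ⟨m + n + 1, rfl⟩)
    rw [heq]
    refine (hC i).closed _ ?_ (range_nonempty _) hcm.isChain_range (mk_range_nat_lt hκ₀ _)
    rintro _ ⟨n, rfl⟩
    exact hcC i _ (hB _)
  · refine ⟨sUnion_mem_PK hκ (fun a ha => (hX ha).1) hcard, fun i hi => ?_⟩
    obtain ⟨a₀, ha₀, hi₀⟩ := hcont X hne i hi
    have heq : ⋃₀ X = ⋃₀ {a ∈ X | a₀ ⊆ a} := by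
      refine Subset.antisymm (sUnion_subset fun a ha => ?_) (sUnion_subset_sUnion fun a ha => ha.1)
      rcases hchain.total ha ha₀ with h | h
      · exact h.trans (subset_sUnion_of_mem ⟨ha₀, Subset.rfl⟩)
      · exact subset_sUnion_of_mem ⟨ha, h⟩
    rw [heq]
    exact (hC i).closed _ (fun a ha => (hX ha.1).2 i (hmono _ _ ha.2 hi₀)) ⟨a₀, ha₀, Subset.rfl⟩
      (hchain.mono fun a ha => ha.1)
      ((Cardinal.mk_le_mk_of_subset fun a ha => ha.1).trans_lt hcard)

/-- The nonstationary ideal is normal. -/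
theorem isNormalIdeal_nonstationary (hκ : κ.IsRegular) (hκ₀ : ℵ₀ < κ) :
    IsNormalIdeal κ lam lam 2 (nonstationary κ lam) := by
  refine ⟨⟨fun A hA => hA.1, ?_, ?_, ?_, ?_⟩, ?_⟩
  · rintro A ⟨hA, b, hb, hbA⟩
    refine ⟨hA, {a ∈ PK κ lam | b ⊆ a}, ⟨fun a ha => ha.1, fun d hd =>
      ⟨b ∪ d, ⟨union_mem_PK hκ₀ hb hd, subset_union_left⟩, subset_union_right⟩,
      fun X hX hne _ hcard => ⟨sUnion_mem_PK hκ (fun a ha => (hX ha).1) hcard, ?_⟩⟩, ?_⟩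
    · obtain ⟨a, ha⟩ := hne
      exact (hX ha).2.trans (subset_sUnion_of_mem ha)
    · rw [← subset_empty_iff, ← hbA]
      exact fun a ha => ⟨ha.1, ha.2.2⟩
  · rintro ⟨-, C, hC, hdisj⟩
    obtain ⟨a, ha, -⟩ := hC.unbounded ∅ (finite_mem_PK hκ₀ finite_empty (empty_subset _))
    have : a ∈ PK κ lam ∩ C := ⟨hC.subset_PK ha, ha⟩
    rw [hdisj] at this
    exact this
  · rintro A ⟨hA, C, hC, hdisj⟩ B hB
    refine ⟨hB.trans hA, C, hC, ?_⟩
    rw [← subset_empty_iff, ← hdisj]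
    exact inter_subset_inter_left C hB
  · intro X hX hcard
    choose C hC hdisj using fun A : X => (hX A.2).2
    refine ⟨sUnion_subset fun A hA => (hX hA).1, _, isClubIn_diag hκ hκ₀ (N := fun _ => univ)
      (fun a _ => by rwa [Cardinal.mk_univ]) (fun _ _ _ => Subset.rfl)
      (fun Y ⟨a, ha⟩ i hi => ⟨a, ha, hi⟩) hC, ?_⟩
    rw [← subset_empty_iff]
    rintro a ⟨⟨A, hA, ha⟩, -, haC⟩
    rw [← hdisj ⟨A, hA⟩]
    exact ⟨ha, haC _ trivial⟩
  · rintro A ⟨hA, hAn⟩ f hf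
    by_contra! hno
    have hfib : ∀ e, {a ∈ A | f a = e} ∈ nonstationary κ lam := by
      intro e
      by_contra hpos
      obtain ⟨a, ha, hne⟩ := hno _ ⟨fun a ha => hA ha.1, hpos⟩ (fun a ha => ha.1) e
      exact hne ha.2
    choose C hC hdisj using fun e => (hfib e).2
    -- For `θ = 2` the values of `f` have fewer than two elements, so only subsingletons of `a` are
    -- needed as indices, and there are fewer than `κ` of them.
    refine hAn ⟨hA, _, isClubIn_diag hκ hκ₀ (N := fun a => {e | e ⊆ a ∧ e.Subsingleton})
      ?_ (fun a b hab e he => ⟨he.1.trans hab, he.2⟩) ?_ hC, ?_⟩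
    · intro a ha
      have hsub : {e | e ⊆ a ∧ e.Subsingleton} ⊆ {∅} ∪ singleton '' a := by
        rintro e ⟨hea, he⟩
        rcases he.eq_empty_or_singleton with rfl | ⟨ξ, rfl⟩
        · exact Or.inl rfl
        · exact Or.inr ⟨ξ, hea rfl, rfl⟩
      refine (Cardinal.mk_le_mk_of_subset hsub).trans_lt ((Cardinal.mk_union_le _ _).trans_lt ?_)
      exact Cardinal.add_lt_of_lt (aleph0_lt_lift hκ₀).le
        ((finite_singleton _).lt_aleph0.trans (aleph0_lt_lift hκ₀))
        (Cardinal.mk_image_le.trans_lt ha.2)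
    · rintro X ⟨a, ha⟩ e ⟨heX, he⟩
      rcases he.eq_empty_or_singleton with rfl | ⟨ξ, rfl⟩
      · exact ⟨a, ha, empty_subset _, he⟩
      · obtain ⟨b, hb, hξ⟩ := heX rfl
        exact ⟨b, hb, singleton_subset_iff.2 hξ, he⟩
    · rw [← subset_empty_iff]
      rintro a ⟨ha, -, haC⟩
      rw [← hdisj (f a)]
      refine ⟨⟨ha, rfl⟩, haC _ ⟨(hf a ha).1.trans inter_subset_left, ?_⟩⟩
      rw [← Cardinal.mk_le_one_iff_set_subsingleton]
      have h2 : #(a ∩ Iio (2 : Cardinal.{u}).ord : Set Ordinal.{u}) ≤ 2 := by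
        refine (Cardinal.mk_le_mk_of_subset inter_subset_right).trans ?_
        rw [Cardinal.mk_Iio_ordinal, card_ord, Cardinal.lift_ofNat]
      have h3 : #(f a) < Order.succ (1 : Cardinal.{u + 1}) := by
        have h12 : Order.succ (1 : Cardinal.{u + 1}) = 2 := by
          simpa [one_add_one_eq_two] using Cardinal.succ_natCast 1
        rw [h12]
        exact (hf a ha).2.trans_le h2
      exact Order.lt_succ_iff.1 h3

/-- In a normal ideal, almost all sets are closed under a given function on finite sets. -/
theorem IsNormalIdeal.not_finset_closed_mem {J : Set (Set (Set Ordinal.{u}))} {θ : Cardinal.{u}}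
    (hJ : IsNormalIdeal κ lam lam θ J) (hκ₀ : ℵ₀ < κ) (hlam : κ ≤ lam) (hθ : 2 ≤ θ)
    (G : Finset Ordinal.{u} → Set Ordinal.{u})
    (hG : ∀ e : Finset Ordinal.{u}, (e : Set Ordinal.{u}) ⊆ Iio lam.ord → G e ∈ PK κ lam) :
    {a ∈ PK κ lam | ∃ e : Finset Ordinal.{u}, (e : Set Ordinal.{u}) ⊆ a ∧ ¬ G e ⊆ a} ∈ J := by
  classical
  -- Induction on the size of `e`: removing one element `ξ` turns the claim into a diagonal union
  -- over `ξ ∈ a` of instances for smaller sets.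
  have key : ∀ (k : ℕ) (G : Finset Ordinal.{u} → Set Ordinal.{u}),
      (∀ e : Finset Ordinal.{u}, (e : Set Ordinal.{u}) ⊆ Iio lam.ord → G e ∈ PK κ lam) →
      {a ∈ PK κ lam | ∃ e : Finset Ordinal.{u}, e.card = k ∧ (e : Set Ordinal.{u}) ⊆ a ∧
        ¬ G e ⊆ a} ∈ J := by
    intro k
    induction k with
    | zero =>
      intro G hG
      refine hJ.downward _ (hJ.not_cone_mem (hG ∅ (by simp))) _ ?_
      rintro a ⟨ha, e, he, -, hGe⟩
      rw [Finset.card_eq_zero] at he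
      exact ⟨ha, he ▸ hGe⟩
    | succ k ih =>
      intro G hG
      refine hJ.downward _ (hJ.diag_mem hκ₀ hlam hθ fun ξ hξ =>
        ih (fun e => G (insert ξ e)) fun e he => hG _ ?_) _ ?_
      · rw [Finset.coe_insert]
        exact insert_subset hξ he
      · rintro a ⟨ha, e, he, hea, hGe⟩
        obtain ⟨ξ, e', -, rfl, he'⟩ := Finset.card_eq_succ.1 he
        rw [Finset.coe_insert, insert_subset_iff] at hea
        exact ⟨ha, ξ, hea.1, ha, e', he', hea.2, hGe⟩
  refine hJ.downward _ (hJ.sUnion_mem (range fun k : ℕ => {a ∈ PK κ lam |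
    ∃ e : Finset Ordinal.{u}, e.card = k ∧ (e : Set Ordinal.{u}) ⊆ a ∧ ¬ G e ⊆ a}) ?_
    (mk_range_nat_lt hκ₀ _)) _ ?_
  · rintro _ ⟨k, rfl⟩
    exact key k G hG
  · rintro a ⟨ha, e, hea, hGe⟩
    exact ⟨_, ⟨e.card, rfl⟩, ha, e, rfl, hea, hGe⟩

/-- Every club contains the range of a monotone assignment on the finite subsets of `λ`. -/
theorem IsClubIn.exists_finset_map {C : Set (Set Ordinal.{u})} (hκ : κ.IsRegular) (hκ₀ : ℵ₀ < κ)
    (hC : IsClubIn κ lam C) : ∃ F : Finset Ordinal.{u} → Set Ordinal.{u},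
      ∀ e : Finset Ordinal.{u}, (e : Set Ordinal.{u}) ⊆ Iio lam.ord →
        F e ∈ C ∧ ↑e ⊆ F e ∧ ∀ e' ⊂ e, F e' ⊆ F e := by
  choose! c hcC hc using hC.unbounded
  let F : Finset Ordinal.{u} → Set Ordinal.{u} := fun e =>
    Finset.strongInduction (p := fun _ => Set Ordinal.{u})
      (fun e ih => c (↑e ∪ ⋃ (e') (h : e' ⊂ e), ih e' h)) e
  have hF : ∀ e, F e = c (↑e ∪ ⋃ (e') (_ : e' ⊂ e), F e') := fun e =>
    Finset.strongInduction_eq _ e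
  have hmem : ∀ e : Finset Ordinal.{u}, (e : Set Ordinal.{u}) ⊆ Iio lam.ord →
      (↑e ∪ ⋃ (e') (_ : e' ⊂ e), F e') ∈ PK κ lam := by
    intro e
    induction e using Finset.strongInduction with
    | H e ih =>
    intro he
    refine union_mem_PK hκ₀ (finite_mem_PK hκ₀ e.finite_toSet he)
      (biUnion_mem_PK (s := {e' | e' ⊂ e}) hκ ?_ fun e' he' => ?_)
    · have : {e' | e' ⊂ e}.Finite := (Finset.finite_toSet e.powerset).subset fun e' he' => by
        simpa using he'.1
      exact this.lt_aleph0.trans (aleph0_lt_lift hκ₀)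
    · rw [hF]
      exact hC.subset_PK (hcC _ (ih e' he' ((Finset.coe_subset.2 he'.1).trans he)))
  refine ⟨F, fun e he => ?_⟩
  have h1 := hcC _ (hmem e he)
  have h2 := hc _ (hmem e he)
  rw [← hF] at h1 h2
  exact ⟨h1, subset_union_left.trans h2, fun e' he' =>
    (subset_iUnion₂ (s := fun e' (_ : e' ⊂ e) => F e') e' he').trans (subset_union_right.trans h2)⟩

/-- A club is closed under the directed unions of a monotone assignment on finite sets. -/
theorem IsClubIn.iUnion_finset_mem {C : Set (Set Ordinal.{u})} (hC : IsClubIn κ lam C)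
    {F : Finset Ordinal.{u} → Set Ordinal.{u}}
    (hF : ∀ e : Finset Ordinal.{u}, (e : Set Ordinal.{u}) ⊆ Iio lam.ord →
        F e ∈ C ∧ ↑e ⊆ F e ∧ ∀ e' ⊂ e, F e' ⊆ F e) (s : Set Ordinal.{u}) (hs : s ∈ PK κ lam) :
    ⋃ (e : Finset Ordinal.{u}) (_ : ↑e ⊆ s), F e ∈ C := by
  induction hc : #s using WellFoundedLT.induction generalizing s with
  | ind c ih =>
  subst hc
  rcases lt_or_ge #s ℵ₀ with hfin | hinf
  · have hsfin : s.Finite := Cardinal.lt_aleph0_iff_set_finite.1 hfin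
    have heq : ⋃ (e : Finset Ordinal.{u}) (_ : ↑e ⊆ s), F e = F hsfin.toFinset := by
      refine Subset.antisymm (iUnion₂_subset fun e he => ?_)
        (subset_iUnion₂_of_subset hsfin.toFinset (by simp) Subset.rfl)
      have hsub : e ⊆ hsfin.toFinset := fun x hx => by simpa using he hx
      rcases hsub.eq_or_ssubset with rfl | h
      · exact Subset.rfl
      · exact (hF _ (by simpa using hs.1)).2.2 e h
    rw [heq]
    exact (hF _ (by simpa using hs.1)).1
  -- An infinite `s` is the increasing union of initial segments of an enumeration of length `|s|`.
  -- These have smaller cardinality, and every finite subset of `s` lies in one of them, so the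
  -- chain closure of `C` applies.
  · obtain ⟨f, hfinj, hflt⟩ := exists_injOn_lt_ord s le_rfl
    let S : Ordinal.{u} → Set Ordinal.{u} := fun x => {z ∈ s | f z ≤ f x}
    let H : Set Ordinal.{u} → Set Ordinal.{u} := fun s =>
      ⋃ (e : Finset Ordinal.{u}) (_ : ↑e ⊆ s), F e
    have hHmono : ∀ a b, a ⊆ b → H a ⊆ H b := fun a b hab =>
      iUnion₂_subset fun e he => subset_iUnion₂_of_subset e (he.trans hab) Subset.rfl
    have hSs : ∀ x, S x ⊆ s := fun x z hz => hz.1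
    have hHS : ∀ x ∈ s, H (S x) ∈ C := by
      intro x hx
      refine ih #(S x) ?_ (S x) (PK_mono hs (hSs x)) rfl
      have h1 := mk_le_of_lt_ord (S := S x) (f := f) (o := Order.succ (f x))
        (hfinj.mono (hSs x)) fun z hz => Order.lt_succ_of_le hz.2
      refine h1.trans_lt (Cardinal.lt_ord.1 ?_)
      exact (Cardinal.isSuccLimit_ord hinf).succ_lt (hflt x hx)
    have hne : s.Nonempty := by
      rw [nonempty_iff_ne_empty]
      rintro rfl
      rw [Cardinal.mk_eq_zero] at hinf
      exact absurd hinf (not_le.2 Cardinal.aleph0_pos)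
    have heq : H s = ⋃₀ ((fun x => H (S x)) '' s) := by
      refine Subset.antisymm (iUnion₂_subset fun e he => ?_) (sUnion_subset ?_)
      · obtain ⟨x, hx, hex⟩ : ∃ x ∈ s, ↑e ⊆ S x := by
          rcases e.eq_empty_or_nonempty with rfl | hene
          · obtain ⟨x, hx⟩ := hne
            exact ⟨x, hx, by simp⟩
          · obtain ⟨x, hx, hmax⟩ := e.exists_max_image f hene
            exact ⟨x, he hx, fun z hz => ⟨he hz, hmax z hz⟩⟩
        have hFe : F e ⊆ H (S x) := subset_iUnion₂_of_subset e hex Subset.rfl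
        exact hFe.trans (subset_sUnion_of_mem ⟨x, hx, rfl⟩)
      · rintro _ ⟨x, -, rfl⟩
        exact hHmono _ _ (hSs x)
    change H s ∈ C
    rw [heq]
    refine hC.closed _ ?_ (hne.image _) ?_ (Cardinal.mk_image_le.trans_lt hs.2)
    · rintro _ ⟨x, hx, rfl⟩
      exact hHS x hx
    · rintro _ ⟨x, -, rfl⟩ _ ⟨z, -, rfl⟩ -
      rcases le_total (f x) (f z) with h | h
      · exact Or.inl (hHmono _ _ fun w hw => ⟨hw.1, hw.2.trans h⟩)
      · exact Or.inr (hHmono _ _ fun w hw => ⟨hw.1, hw.2.trans h⟩)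

/-- Any `a` closed under the finite-set map `F` of a club is the directed union of the `F e`, `e ⊆
a` finite, and so belongs to the club. Thus a set missing the club consists of points not closed
under `F`, which every normal ideal contains. -/
theorem nonstationary_eq_NSnormal (hκ : κ.IsRegular) (hκ₀ : ℵ₀ < κ) (hlam : κ ≤ lam) :
    nonstationary κ lam = NSnormal κ lam lam 2 := by
  refine Subset.antisymm ?_ (sInter_subset_of_mem (isNormalIdeal_nonstationary hκ hκ₀))
  rintro A ⟨hA, C, hC, hdisj⟩ J hJ
  obtain ⟨F, hF⟩ := hC.exists_finset_map hκ hκ₀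
  refine hJ.downward _ (hJ.not_finset_closed_mem hκ₀ hlam le_rfl F
    fun e he => hC.subset_PK (hF e he).1) _ fun a ha => ⟨hA ha, ?_⟩
  by_contra! hcl
  have haC := hC.iUnion_finset_mem hF a (hA ha)
  have heq : ⋃ (e : Finset Ordinal.{u}) (_ : ↑e ⊆ a), F e = a := by
    refine Subset.antisymm (iUnion₂_subset hcl) fun ξ hξ => ?_
    have hξa : ((({ξ} : Finset Ordinal.{u})) : Set Ordinal.{u}) ⊆ a := by simpa using hξ
    exact mem_iUnion₂.2 ⟨{ξ}, hξa, (hF {ξ} (hξa.trans (hA ha).1)).2.1 (by simp)⟩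
  rw [heq] at haC
  have : a ∈ A ∩ C := ⟨ha, haC⟩
  rw [hdisj] at this
  exact this

theorem cofBar_le_of_subset_PK {τ : Cardinal.{u}} {I : Set (Set (Set Ordinal.{u}))}
    (hκ₀ : ℵ₀ < κ) (hI : ∀ A ∈ I, A ⊆ PK κ τ) :
    cofBar κ I ≤ Cardinal.lift.{u + 1} ((2 : Cardinal.{u}) ^ (2 : Cardinal.{u}) ^ τ) := by
  have h1 : cofBar κ I ≤ #I := csInf_le' ⟨I, Subset.rfl, fun A hA =>
    ⟨{A}, singleton_subset_iff.2 hA, (finite_singleton A).lt_aleph0.trans (aleph0_lt_lift hκ₀),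
      by simp⟩, rfl⟩
  have h2 : I ⊆ 𝒫 𝒫 (Iio τ.ord) := fun A hA a ha => (hI A hA ha).1
  refine h1.trans ((Cardinal.mk_le_mk_of_subset h2).trans ?_)
  rw [Cardinal.mk_powerset, Cardinal.mk_powerset, Cardinal.mk_Iio_ordinal, card_ord]
  simp only [Cardinal.lift_power, Cardinal.lift_two, le_refl]

theorem nonstationary_isNowherePrecipitous (hκ : κ.IsRegular) (hκ₀ : ℵ₀ < κ)
    (hlam : lam.IsSingular) (hcf : κ ≤ lam.ord.cof) (hlim : lam.IsStrongLimit) :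
    IsNowherePrecipitous κ lam (nonstationary κ lam) := by
  have hμ := hlam.cof_ord_lt
  have hκlam : κ < lam := hcf.trans_lt hμ
  have htwo : (2 : Cardinal.{u}) ≤ κ := by exact_mod_cast (hκ.nat_lt 2).le
  rw [nonstationary_eq_NSnormal hκ hκ₀ hκlam.le]
  refine NSnormal_isNowherePrecipitous hκ hκ₀ hlam hcf le_rfl htwo
    ⟨_, isNormalIdeal_nonstationary hκ hκ₀⟩ (fun τ hτ hτlam => ?_) fun τ hτ hτlam => ?_
  · calc τ ^ lam.ord.cof ≤ (2 ^ τ) ^ lam.ord.cof :=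
          Cardinal.power_le_power_right (Cardinal.cantor τ).le
      _ = 2 ^ (τ * lam.ord.cof) := Cardinal.power_mul.symm
      _ < lam := hlim.isStrongPrelimit (Cardinal.mul_lt_of_lt hlam.aleph0_le hτlam hμ)
  · refine (cofBar_le_of_subset_PK hκ₀ fun A hA =>
      (hA _ (isNormalIdeal_nonstationary hκ hκ₀)).1).trans (Cardinal.lift_le.2 ?_)
    have hbar : thetaBar κ 2 = 2 := by
      unfold thetaBar
      rw [dif_neg]
      rintro ⟨h, -⟩
      exact absurd (hκ.nat_lt 2) (by rw [← h]; exact_mod_cast lt_irrefl _)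
    rw [hbar]
    -- The trivial bound `2 ^ 2 ^ τ` on the size of an ideal is already below `λ`, and `λ = λ ^ 1 ≤
    -- λ ^< 2`.
    refine (hlim.isStrongPrelimit (hlim.isStrongPrelimit hτlam)).le.trans ?_
    simpa using Cardinal.le_powerlt lam (Cardinal.one_lt_two)

end Club

end PKappaLambda

theorem proposition3p4 (κ lam : Cardinal.{u}) (hκ : κ.IsRegular) (hκ₀ : ℵ₀ < κ)
    (hlam : lam.IsSingular) (hcf : κ ≤ lam.ord.cof) :
    (∀ θ : Cardinal.{u}, 2 ≤ θ → θ ≤ κ →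
      (∃ J, PKappaLambda.IsNormalIdeal κ lam lam θ J) →
      (∀ τ : Cardinal.{u}, κ ≤ τ → τ < lam →
        τ ^ lam.ord.cof < lam ∧
        PKappaLambda.cofBar κ (PKappaLambda.NSnormal κ τ τ θ) ≤
          Cardinal.lift.{u + 1} (lam ^< PKappaLambda.thetaBar κ θ)) →
      PKappaLambda.IsNowherePrecipitous κ lam (PKappaLambda.NSnormal κ lam lam θ)) ∧
    (lam.IsStrongLimit →
      PKappaLambda.IsNowherePrecipitous κ lam (PKappaLambda.nonstationary κ lam)) :=
  ⟨fun _ hθ hθκ hex h => PKappaLambda.NSnormal_isNowherePrecipitous hκ hκ₀ hlam hcf hθ hθκ hex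
    (fun τ h₁ h₂ => (h τ h₁ h₂).1) fun τ h₁ h₂ => (h τ h₁ h₂).2,
  PKappaLambda.nonstationary_isNowherePrecipitous hκ hκ₀ hlam hcf⟩
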